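/- Let $n\ge 2$ and let $\Omega\subset\mathbb R^n$ be a bounded domain (open, connected, non-empty). For $x\in\Omega$ let $d(x)$ be the distance from $x$ to $\partial\Omega$, and let $\delta(x,z)=\min\{d(x),d(z)\}$. For $\beta\ge 1$, $\Omega$ is called a $\beta$-John domain if there are a point $x_0\in\Omega$, positive constants $\lambda,K,C_0$ and rectifiable curves $\gamma(\cdot,y):[0,1]\to\Omega$, one for each $y\in\Omega$, such that (1) $\gamma(0,y)=y$ and $\gamma(1,y)=x_0$; (2) $d(\gamma(t,y))\ge\lambda t^\beta$ for $0\le t\le 1$; (3) $|\dot\gamma(t,y)|\le K$ (that is, $\gamma(\cdot,y)$ is Lipschitz with constant $K$); (4) for all $x,y\in\Omega$ and all $r\le\frac12 d(x)$, the part of the curve $\gamma(\cdot,y)$ inside the ball $B(x,r)$ has length at most $C_0r$. **Theorem.** Let $\Omega\subset\mathbb R^n$ be a $\beta$-John domain, $0<s<1$, $1<p\le q<\infty$, $a\ge 0$, $$b<\frac{(n+a)p}{q\beta}+\frac{p-1}{\beta}+sp-p+1-n,$$ and, additionally, $q\le\frac{np}{n-sp}$ if $p<\frac ns$. Then there is a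 constant $C>0$ such that for every $f\in C^\infty(\Omega)$ (real-valued) $$\inf_{c\in\mathbb R}\Big(\int_\Omega|f(y)-c|^q\,d(y)^a\,dy\Big)^{1/q}\le C\left\{\int_\Omega\int_{|x-z|\le d(x)/2}\frac{|f(z)-f(x)|^p}{|z-x|^{n+sp}}\,\delta(x,z)^b\,dz\,dx\right\}^{1/p},$$ where both sides are allowed to be $+\infty$. -/

import Mathlib

open MeasureTheory Set
open scoped NNReal ENNReal ContDiff

/-- The distance `d(x)` from `x` to the boundary of `Ω`. -/
noncomputable def bdryDist {n : ℕ} (Ω : Set (EuclideanSpace ℝ (Fin n)))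
    (x : EuclideanSpace ℝ (Fin n)) : ℝ :=
  Metric.infDist x (frontier Ω)

/-- `δ(x, z) = min {d(x), d(z)}`. -/
noncomputable def minBdryDist {n : ℕ} (Ω : Set (EuclideanSpace ℝ (Fin n)))
    (x z : EuclideanSpace ℝ (Fin n)) : ℝ :=
  min (bdryDist Ω x) (bdryDist Ω z)

/-- The length of the part, inside the set `S`, of the (Lipschitz) curve `c : [0, 1] → ℝⁿ`,
i.e. the integral of the speed over the parameters `t` with `c t ∈ S`. -/
noncomputable def lengthInside {n : ℕ} (c : ℝ → EuclideanSpace ℝ (Fin n))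
    (S : Set (EuclideanSpace ℝ (Fin n))) : ℝ≥0∞ :=
  ∫⁻ t in {t ∈ Icc (0 : ℝ) 1 | c t ∈ S}, ‖deriv c t‖ₑ

/-- `γ` is a family of curves `γ y : [0, 1] → Ω` (`y ∈ Ω`) that joins each point `y` of `Ω` to the
centre `x₀`, with exponent `β` and constants `lam`, `K`, `C`. -/
structure IsJohnFamily {n : ℕ} (β : ℝ) (Ω : Set (EuclideanSpace ℝ (Fin n)))
    (x₀ : EuclideanSpace ℝ (Fin n))
    (γ : EuclideanSpace ℝ (Fin n) → ℝ → EuclideanSpace ℝ (Fin n))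
    (lam : ℝ) (K : ℝ≥0) (C : ℝ) : Prop where
  mem : ∀ y ∈ Ω, ∀ t ∈ Icc (0 : ℝ) 1, γ y t ∈ Ω
  start : ∀ y ∈ Ω, γ y 0 = y
  finish : ∀ y ∈ Ω, γ y 1 = x₀
  twisted_cone : ∀ y ∈ Ω, ∀ t ∈ Icc (0 : ℝ) 1, lam * t ^ β ≤ bdryDist Ω (γ y t)
  /-- The curves are rectifiable, with speed at most `K`. -/
  speed_le : ∀ y ∈ Ω, LipschitzOnWith K (γ y) (Icc (0 : ℝ) 1)
  length_le : ∀ x ∈ Ω, ∀ y ∈ Ω, ∀ r : ℝ, r ≤ bdryDist Ω x / 2 →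
    lengthInside (γ y) (Metric.ball x r) ≤ ENNReal.ofReal (C * r)

/-- `Ω` is a (bounded) `β`-John domain in `ℝⁿ`. -/
structure IsJohnDomain {n : ℕ} (β : ℝ) (Ω : Set (EuclideanSpace ℝ (Fin n))) : Prop where
  isOpen : IsOpen Ω
  isConnected : IsConnected Ω
  isBounded : Bornology.IsBounded Ω
  one_le : 1 ≤ β
  exists_family : ∃ x₀ ∈ Ω, ∃ γ : EuclideanSpace ℝ (Fin n) → ℝ → EuclideanSpace ℝ (Fin n),
    ∃ (lam : ℝ) (K : ℝ≥0) (C : ℝ), 0 < lam ∧ 0 < K ∧ 0 < C ∧ IsJohnFamily β Ω x₀ γ lam K C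

/-- The measure `d(x)^a dx` on `Ω`, whose `L^q` norm is that of `L^q(Ω, d^a)`. -/
noncomputable def weightedMeasure {n : ℕ} (Ω : Set (EuclideanSpace ℝ (Fin n))) (a : ℝ) :
    Measure (EuclideanSpace ℝ (Fin n)) :=
  (volume.restrict Ω).withDensity fun x => ENNReal.ofReal (bdryDist Ω x ^ a)

/-- The weighted fractional seminorm
`(∫_Ω ∫_{|x-z| ≤ d(x)/2} |f(z)-f(x)|^p / |z-x|^(n+sp) δ(x,z)^b dz dx)^(1/p)`, in `[0, ∞]`. -/
noncomputable def fracSeminorm {n : ℕ} (Ω : Set (EuclideanSpace ℝ (Fin n))) (s p b : ℝ)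
    (f : EuclideanSpace ℝ (Fin n) → ℝ) : ℝ≥0∞ :=
  (∫⁻ x in Ω, ∫⁻ z in {z | z ∈ Ω ∧ ‖x - z‖ ≤ bdryDist Ω x / 2},
    ENNReal.ofReal (|f z - f x| ^ p / ‖z - x‖ ^ ((n : ℝ) + s * p) * minBdryDist Ω x z ^ b))
      ^ (1 / p)

/-! Let A(x) (`tentAverage`) be the average of f against a tent of radius d(x)/20 centred at x. With
c = A(x₀), the difference f - c splits into a local error f - A and a transport term A - A(x₀).

Local error. On a ball of radius d(x)/20 the weight is essentially constant, so a scale-invariant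
fractional Sobolev–Poincaré inequality (`exists_lintegral_ball_rpow_le`) applies; this is where q ≤
np/(n - sp) enters. It follows from a Hedberg-type argument: at every scale t, |f(y) - m| is at most
a constant times t^(n/p-n/q) g(y) + t^(-n/q) ‖f - m‖_q, where g(y)^p is the energy seen from y.
Optimising t, raising to the power q and integrating in y leaves a power of ‖f - m‖_q that is
absorbed, the norm being finite a priori. Local estimates are summed by integrating over all centres
x, in place of a Whitney covering.

Transport term. A is locally Lipschitz, with constant near x bounded by a power of d(x) times the
p-th root of the energy near x. The fundamental theorem of calculus along γ(·, y) and Hölder with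
the weight d^(-σ), whose line integral converges because d(γ(t, y)) ≥ λ t^β and σβ < 1, bound |A(y)
- A(x₀)|^p by a line integral of local energies. By Fubini, a point w counts only along a piece of
the curve of length at most a multiple of d(w), by condition (4), and only if y lies in the shadow
|w - y| ≤ C d(w)^(1/β) of w. Jensen's inequality with exponent q/p ≥ 1 and integration in y finish
the proof: the shadow has d^a-mass at most a multiple of d(w)^((n+a)/β). The power of d(w) left over
is nonnegative exactly when b ≤ (n+a)p/(qβ) + σ(p-1) + sp - p + 1 - n, and σ may be taken as close
to 1/β as the strict bound on b requires. -/

/-! ### Hölder and Jensen inequalities in `ℝ≥0∞` -/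

theorem ENNReal.rpow_le_mul_rpow_of_le_of_le {c x y : ℝ≥0∞} (hc : c ≠ ⊤) (hc1 : 1 ≤ c)
    (hxy : x ≤ c * y) (hyx : y ≤ c * x) (μ : ℝ) : x ^ μ ≤ c ^ |μ| * y ^ μ := by
  have hc0 : c ≠ 0 := (zero_lt_one.trans_le hc1).ne'
  rcases le_total 0 μ with h | h
  · rw [abs_of_nonneg h, ← ENNReal.mul_rpow_of_nonneg _ _ h]
    exact ENNReal.rpow_le_rpow hxy h
  · obtain ⟨ν, rfl⟩ : ∃ ν, μ = -ν := ⟨-μ, by ring⟩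
    have hν : 0 ≤ ν := by linarith
    rw [abs_neg, abs_of_nonneg hν, ENNReal.rpow_neg, ENNReal.rpow_neg]
    have h1 : y ^ ν ≤ c ^ ν * x ^ ν := by
      rw [← ENNReal.mul_rpow_of_nonneg _ _ hν]
      exact ENNReal.rpow_le_rpow hyx hν
    have hcν0 : c ^ ν ≠ 0 := by simp [hc0, hc]
    have hcν : c ^ ν ≠ ⊤ := ENNReal.rpow_ne_top_of_nonneg hν hc
    calc (x ^ ν)⁻¹ = c ^ ν * (c ^ ν * x ^ ν)⁻¹ := by
          rw [ENNReal.mul_inv (Or.inl hcν0) (Or.inl hcν), ← mul_assoc,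
            ENNReal.mul_inv_cancel hcν0 hcν, one_mul]
      _ ≤ _ := by gcongr

theorem lintegral_le_measure_univ_rpow_mul {α : Type*} [MeasurableSpace α] {μ : Measure α}
    {p : ℝ} (hp : 1 ≤ p) {F : α → ℝ≥0∞} (hF : AEMeasurable F μ) :
    ∫⁻ x, F x ∂μ ≤ μ univ ^ (1 - 1 / p) * (∫⁻ x, F x ^ p ∂μ) ^ (1 / p) := by
  rcases hp.eq_or_lt with rfl | hp1
  · simp
  · have hpq := Real.HolderConjugate.conjExponent hp1
    have := ENNReal.lintegral_mul_le_Lp_mul_Lq μ hpq hF (aemeasurable_const (b := (1 : ℝ≥0∞)))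
    simp only [Pi.mul_apply, mul_one, ENNReal.one_rpow, lintegral_const, one_mul] at this
    rw [mul_comm]
    have e : 1 / Real.conjExponent p = 1 - 1 / p := by
      have := hpq.inv_add_inv_eq_one
      simp only [one_div]; linarith
    rwa [e] at this

theorem rpow_lintegral_le_measure_univ_rpow_mul {α : Type*} [MeasurableSpace α] {μ : Measure α}
    {p : ℝ} (hp : 1 ≤ p) {F : α → ℝ≥0∞} (hF : AEMeasurable F μ) :
    (∫⁻ x, F x ∂μ) ^ p ≤ μ univ ^ (p - 1) * ∫⁻ x, F x ^ p ∂μ := by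
  have hp0 : 0 < p := by linarith
  have := ENNReal.rpow_le_rpow (lintegral_le_measure_univ_rpow_mul hp hF) hp0.le
  rw [ENNReal.mul_rpow_of_nonneg _ _ hp0.le, ← ENNReal.rpow_mul, ← ENNReal.rpow_mul] at this
  rwa [show (1 - 1 / p) * p = p - 1 by field_simp, show 1 / p * p = 1 by field_simp,
    ENNReal.rpow_one] at this

/-- Jensen's inequality for the measure with density `H`, not normalised. It serves twice: along a
curve, with `H` the speed times d^(-σ), and on Ω, with `H` the inner energy and exponent q/p. -/
theorem rpow_lintegral_mul_le {α : Type*} [MeasurableSpace α] {μ : Measure α}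
    {p : ℝ} (hp : 1 ≤ p) {F H : α → ℝ≥0∞} (hF : Measurable F) (hH : Measurable H) :
    (∫⁻ x, H x * F x ∂μ) ^ p ≤ (∫⁻ x, H x ∂μ) ^ (p - 1) * ∫⁻ x, H x * F x ^ p ∂μ := by
  have := rpow_lintegral_le_measure_univ_rpow_mul (μ := μ.withDensity H) hp hF.aemeasurable
  rw [lintegral_withDensity_eq_lintegral_mul _ hH hF,
    lintegral_withDensity_eq_lintegral_mul _ hH (hF.pow_const p),
    withDensity_apply _ MeasurableSet.univ] at this
  simpa using this

theorem ENNReal.add_rpow_le_two_rpow_mul {q : ℝ} (hq : 0 ≤ q) (x y : ℝ≥0∞) :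
    (x + y) ^ q ≤ 2 ^ q * (x ^ q + y ^ q) := by
  have h : x + y ≤ 2 * max x y := by
    rw [two_mul]; exact add_le_add (le_max_left _ _) (le_max_right _ _)
  calc (x + y) ^ q ≤ (2 * max x y) ^ q := ENNReal.rpow_le_rpow h hq
    _ = 2 ^ q * (max x y) ^ q := ENNReal.mul_rpow_of_nonneg _ _ hq
    _ ≤ _ := by
      gcongr
      rcases le_total x y with h | h
      · rw [max_eq_right h]; exact le_add_self
      · rw [max_eq_left h]; exact le_self_add

theorem volume_ball_eq_rpow {n : ℕ} (x : EuclideanSpace ℝ (Fin n)) {r : ℝ} (hr : 0 < r) :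
    volume (Metric.ball x r) =
      ENNReal.ofReal r ^ (n : ℝ) * volume (Metric.ball (0 : EuclideanSpace ℝ (Fin n)) 1) := by
  rw [Measure.addHaar_ball_of_pos _ _ hr, finrank_euclideanSpace_fin, ENNReal.rpow_natCast,
    ENNReal.ofReal_pow hr.le]

/-! ### Fractional Sobolev–Poincaré inequality on balls -/

/-- Optimisation of the scale in Hedberg's argument. The two terms of `ha` balance at T =
(M/g)^(p/n), where both equal M^(1-p/q) g^(p/q). If this T exceeds the largest admissible scale R,
then `hb` is already enough, because the exponent n/p - n/q is nonnegative. -/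
theorem rpow_le_of_interpolation {n : ℕ} (hn : 0 < n) {p q : ℝ} (hp : 1 ≤ p) (hpq : p ≤ q)
    {C U g M R : ℝ≥0∞} (hC : 1 ≤ C) (hM0 : M ≠ 0) (hM : M ≠ ⊤)
    (ha : ∀ T : ℝ≥0∞, T ≠ 0 → T ≤ R → U ≤ C * (T ^ (n / p - n / q) * g + T ^ (-(n / q)) * M))
    (hb : U ≤ C * (R ^ (n / p - n / q) * g)) :
    U ^ q ≤ (2 * C) ^ q * (M ^ (q - p) * g ^ p) := by
  have hp0 : 0 < p := by linarith
  have hq0 : 0 < q := by linarith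
  have hn0 : (0 : ℝ) < n := by exact_mod_cast hn
  have hα : 0 ≤ n / p - n / q := by
    rw [sub_nonneg]; gcongr
  have hC0 : C ≠ 0 := (zero_lt_one.trans_le hC).ne'
  rcases eq_or_ne g 0 with rfl | hg0
  · have : U = 0 := by simpa using hb
    simp [this, hq0]
  rcases eq_or_ne g ⊤ with rfl | hg
  · have h1 : M ^ (q - p) ≠ 0 := by
      simp [hM0, hM]
    have h2 : (2 * C) ^ q ≠ 0 := by simp [hC0, hq0.le, hq0]
    simp [hp0, ENNReal.mul_top h1, ENNReal.mul_top h2]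
  set P := (M / g) ^ (p / n) with hP
  have hMg0 : M / g ≠ 0 := by simp [ENNReal.div_eq_zero_iff, hM0, hg]
  have hMg : M / g ≠ ⊤ := by simp [ENNReal.div_eq_top, hg0, hM]
  have hP0 : P ≠ 0 := by simp [hP, hMg0, hMg]
  have e1 : P ^ (n / p - n / q) * g = M ^ (1 - p / q) * g ^ (p / q) := by
    rw [hP, ← ENNReal.rpow_mul, show p / n * (n / p - n / q) = 1 - p / q by field_simp,
      ENNReal.div_rpow_of_nonneg _ _ (by rw [sub_nonneg, div_le_one hq0]; exact hpq),
      ENNReal.div_eq_inv_mul, ← ENNReal.rpow_neg, mul_comm, ← mul_assoc]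
    nth_rw 1 [← ENNReal.rpow_one g]
    rw [← ENNReal.rpow_add _ _ hg0 hg, mul_comm]
    congr 2; ring
  have e2 : P ^ (-(n / q)) * M = M ^ (1 - p / q) * g ^ (p / q) := by
    rw [hP, ← ENNReal.rpow_mul, show p / n * (-(n / q)) = -(p / q) by field_simp,
      ENNReal.rpow_neg, ENNReal.div_rpow_of_nonneg _ _ (by positivity),
      ENNReal.inv_div (Or.inl (ENNReal.rpow_ne_top_of_nonneg (by positivity) hg))
        (Or.inl (by simp [hg0, hg])), ENNReal.div_eq_inv_mul,
      ← ENNReal.rpow_neg, mul_comm, ← mul_assoc]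
    nth_rw 1 [← ENNReal.rpow_one M]
    rw [← ENNReal.rpow_add _ _ hM0 hM]
    congr 2
  have key : U ≤ 2 * C * (M ^ (1 - p / q) * g ^ (p / q)) := by
    rcases le_total P R with h | h
    · refine (ha P hP0 h).trans (le_of_eq ?_)
      rw [e1, e2]; ring
    · refine hb.trans ?_
      rw [← e1]
      calc C * (R ^ (n / p - n / q) * g) ≤ C * (P ^ (n / p - n / q) * g) := by gcongr
        _ ≤ 2 * C * (P ^ (n / p - n / q) * g) := by
          rw [mul_assoc, two_mul]; exact le_self_add
  refine (ENNReal.rpow_le_rpow key hq0.le).trans (le_of_eq ?_)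
  rw [ENNReal.mul_rpow_of_nonneg _ _ hq0.le, ENNReal.mul_rpow_of_nonneg _ _ hq0.le,
    ENNReal.mul_rpow_of_nonneg _ _ hq0.le, ← ENNReal.rpow_mul, ← ENNReal.rpow_mul]
  congr 3 <;> field_simp

/-- Hölder on a ball at scale t; the exponent is -n/p + (2n - np/q)/p = n/p - n/q. The distance 4t
leaves room for a ball that is not centred at the base point. -/
theorem exists_lintegral_ball_enorm_sub_le {n : ℕ} {p q : ℝ} (hp : 1 ≤ p) (hpq : p ≤ q) :
    ∃ C : ℝ≥0∞, C ≠ ⊤ ∧ ∀ (x : EuclideanSpace ℝ (Fin n)) (t : ℝ) (_ : 0 < t)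
      (F G : EuclideanSpace ℝ (Fin n) → ℝ≥0∞), Measurable F →
      (∀ z ∈ Metric.ball x t, F z ^ p ≤ ENNReal.ofReal (4 * t) ^ (2 * n - n * p / q) * G z) →
      ∫⁻ z in Metric.ball x t, F z ≤ volume (Metric.ball x t) *
        (C * (ENNReal.ofReal t ^ (n / p - n / q) *
          (∫⁻ z in Metric.ball x t, G z) ^ (1 / p))) := by
  set v₁ := volume (Metric.ball (0 : EuclideanSpace ℝ (Fin n)) 1) with hv₁
  have hv₁0 : v₁ ≠ 0 := (Metric.measure_ball_pos _ _ one_pos).ne'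
  have hv₁t : v₁ ≠ ⊤ := measure_ball_lt_top.ne
  have hp0 : 0 < p := by linarith
  have hq0 : 0 < q := by linarith
  have hexp : 0 ≤ 2 * n - n * p / q := by
    have : n * p / q ≤ n * 1 := by
      rw [mul_div_assoc]; gcongr; rwa [div_le_one hq0]
    have : (0 : ℝ) ≤ n := by positivity
    linarith
  refine ⟨v₁ ^ (-(1 / p)) * 4 ^ ((2 * n - n * p / q) / p), ?_, ?_⟩
  · exact ENNReal.mul_ne_top (by simp [hv₁0, hv₁t])
      (ENNReal.rpow_ne_top_of_nonneg (by positivity) (by norm_num))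
  intro x t ht F G hF hFG
  set T := ENNReal.ofReal t with hT
  have hT0 : T ≠ 0 := by simpa [hT] using ht
  have hTt : T ≠ ⊤ := ENNReal.ofReal_ne_top
  set V := volume (Metric.ball x t) with hV
  have hVeq : V = T ^ (n : ℝ) * v₁ := volume_ball_eq_rpow x ht
  have hV0 : V ≠ 0 := (Metric.measure_ball_pos _ _ ht).ne'
  have hVt : V ≠ ⊤ := measure_ball_lt_top.ne
  have h1 := lintegral_le_measure_univ_rpow_mul (μ := volume.restrict (Metric.ball x t)) hp
    hF.aemeasurable
  rw [Measure.restrict_apply_univ] at h1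
  refine h1.trans ?_
  have h4 : ENNReal.ofReal (4 * t) = 4 * T := by
    rw [ENNReal.ofReal_mul (by norm_num)]; norm_num [hT]
  have h2 : ∫⁻ z in Metric.ball x t, F z ^ p ≤
      (4 * T) ^ (2 * n - n * p / q) * ∫⁻ z in Metric.ball x t, G z := by
    rw [← lintegral_const_mul' _ _ (ENNReal.rpow_ne_top_of_nonneg hexp
      (ENNReal.mul_ne_top (by norm_num) hTt))]
    refine setLIntegral_mono' measurableSet_ball fun z hz => ?_
    rw [← h4]; exact hFG z hz
  calc V ^ (1 - 1 / p) * (∫⁻ z in Metric.ball x t, F z ^ p) ^ (1 / p)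
      ≤ V ^ (1 - 1 / p) * ((4 * T) ^ (2 * n - n * p / q) *
          ∫⁻ z in Metric.ball x t, G z) ^ (1 / p) := by gcongr
    _ = V * (v₁ ^ (-(1 / p)) * 4 ^ ((2 * n - n * p / q) / p) *
        (T ^ (n / p - n / q) * (∫⁻ z in Metric.ball x t, G z) ^ (1 / p))) := by
      rw [ENNReal.mul_rpow_of_nonneg _ _ (by positivity), ← ENNReal.rpow_mul, sub_eq_add_neg,
        ENNReal.rpow_add _ _ hV0 hVt, ENNReal.rpow_one]
      have : V ^ (-(1 / p)) = T ^ (-(n / p)) * v₁ ^ (-(1 / p)) := by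
        rw [hVeq, ENNReal.mul_rpow_of_ne_top (ENNReal.rpow_ne_top_of_nonneg (by positivity) hTt)
          hv₁t, ← ENNReal.rpow_mul]
        congr 2; ring
      rw [this, mul_one_div, ENNReal.mul_rpow_of_nonneg _ _ (by positivity),
        show n / p - n / q = -(n / p) + (2 * n - n * p / q) / p by field_simp; ring,
        ENNReal.rpow_add _ _ hT0 hTt]
      ring

/-- A point of a ball is within `2 t` of a ball of radius `t` contained in the large one. -/
theorem exists_ball_subset_ball_of_mem_ball {E : Type*} [NormedAddCommGroup E] [NormedSpace ℝ E]
    {x y : E} {r t : ℝ} (hy : y ∈ Metric.ball x r) (ht : 0 < t) (htr : t ≤ r / 2) :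
    ∃ y', Metric.ball y' t ⊆ Metric.ball x r ∧ Metric.ball y' t ⊆ Metric.ball y (4 * t) := by
  have hr : 0 < r := by linarith
  -- Sliding y towards the centre by the fraction t/r costs at most t and brings it within r - t of
  -- the centre.
  refine ⟨y + (t / r) • (x - y), ?_, ?_⟩
  · refine Metric.ball_subset_ball' ?_
    have : y + (t / r) • (x - y) - x = (1 - t / r) • (y - x) := by
      rw [sub_smul, one_smul, smul_sub, smul_sub]; abel
    rw [dist_eq_norm, this, norm_smul, Real.norm_of_nonneg
      (by rw [sub_nonneg, div_le_one hr]; linarith)]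
    have h1 : ‖y - x‖ ≤ r := by rw [← dist_eq_norm]; exact (Metric.mem_ball.1 hy).le
    have h2 : (1 - t / r) * ‖y - x‖ ≤ (1 - t / r) * r := by
      gcongr; rw [sub_nonneg, div_le_one hr]; linarith
    have h3 : (1 - t / r) * r = r - t := by field_simp
    linarith
  · refine Metric.ball_subset_ball' ?_
    rw [dist_eq_norm, add_sub_cancel_left, norm_smul, Real.norm_of_nonneg (by positivity)]
    have h1 : ‖x - y‖ ≤ r := by
      rw [← dist_eq_norm, dist_comm]; exact (Metric.mem_ball.1 hy).le
    have h2 : t / r * ‖x - y‖ ≤ t / r * r := by gcongr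
    have h3 : t / r * r = t := by field_simp
    linarith

/-- A fractional Sobolev–Poincaré inequality on balls, with a scale-invariant constant. -/
theorem exists_lintegral_ball_rpow_le {n : ℕ} (hn : 0 < n) {p q : ℝ} (hp : 1 ≤ p) (hpq : p ≤ q)
    {C₀ : ℝ≥0∞} (hC₀ : C₀ ≠ ⊤) :
    ∃ C : ℝ≥0∞, C ≠ ⊤ ∧ ∀ (x : EuclideanSpace ℝ (Fin n)) (r : ℝ) (_ : 0 < r)
      (f : EuclideanSpace ℝ (Fin n) → ℝ) (m : ℝ)
      (W : EuclideanSpace ℝ (Fin n) → EuclideanSpace ℝ (Fin n) → ℝ≥0∞), Measurable f →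
      (∀ y ∈ Metric.ball x r, ∀ z ∈ Metric.ball x r,
        ‖f y - f z‖ₑ ^ p ≤ ENNReal.ofReal (dist y z) ^ (2 * n - n * p / q) * W y z) →
      (∀ y ∈ Metric.ball x r, volume (Metric.ball x r) * ‖f y - m‖ₑ ≤
        C₀ * ∫⁻ z in Metric.ball x r, ‖f y - f z‖ₑ) →
      ∫⁻ y in Metric.ball x r, ‖f y - m‖ₑ ^ q ≠ ⊤ →
      ∫⁻ y in Metric.ball x r, ‖f y - m‖ₑ ^ q ≤
        C * (∫⁻ y in Metric.ball x r, ∫⁻ z in Metric.ball x r, W y z) ^ (q / p) := by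
  set v₁ := volume (Metric.ball (0 : EuclideanSpace ℝ (Fin n)) 1) with hv₁
  have hv₁0 : v₁ ≠ 0 := (Metric.measure_ball_pos _ _ one_pos).ne'
  have hv₁t : v₁ ≠ ⊤ := measure_ball_lt_top.ne
  have hp0 : 0 < p := by linarith
  have hq0 : 0 < q := by linarith
  have hexp : 0 ≤ 2 * n - n * p / q := by
    have : n * p / q ≤ n * 1 := by
      rw [mul_div_assoc]; gcongr; rwa [div_le_one hq0]
    have : (0 : ℝ) ≤ n := by positivity
    linarith
  have hα : 0 ≤ n / p - n / q := by rw [sub_nonneg]; gcongr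
  obtain ⟨C₁, hC₁, H⟩ := exists_lintegral_ball_enorm_sub_le (n := n) hp hpq
  have h2top : (2 : ℝ≥0∞) ^ (n / p - n / q) ≠ ⊤ :=
    ENNReal.rpow_ne_top_of_nonneg hα (by norm_num)
  -- A single constant dominating the three that occur: `C₁` for the oscillation, v₁^(-1/q) for the
  -- mean at a small scale, and the last summand for the full ball, compared with scale r/2.
  set C := 1 + C₁ + v₁ ^ (-(1 / q)) + C₀ * C₁ * 2 ^ (n / p - n / q) with hC
  have hCt : C ≠ ⊤ := by
    simp [hC, hC₁, hv₁0, hv₁t, ENNReal.mul_ne_top, hC₀, h2top]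
  have hC1 : 1 ≤ C := by rw [hC, add_assoc, add_assoc]; exact le_self_add
  have hCa : C₁ ≤ C := by
    rw [hC, add_comm 1 C₁, add_assoc, add_assoc]; exact le_self_add
  have hCb : v₁ ^ (-(1 / q)) ≤ C := by
    rw [hC, add_right_comm]; exact le_add_self
  have hCc : C₀ * C₁ * 2 ^ (n / p - n / q) ≤ C := le_add_self
  refine ⟨((2 * C) ^ q) ^ (q / p), ENNReal.rpow_ne_top_of_nonneg (by positivity)
    (ENNReal.rpow_ne_top_of_nonneg hq0.le (ENNReal.mul_ne_top (by norm_num) hCt)), ?_⟩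
  intro x r hr f m W hf hW hm hfin
  set B := Metric.ball x r with hB
  set N := ∫⁻ y in B, ‖f y - m‖ₑ ^ q with hN
  rcases eq_or_ne N 0 with h0 | h0
  · rw [h0]; exact zero_le
  set M := N ^ (1 / q) with hM
  have hM0 : M ≠ 0 := by simp [hM, h0, hfin]
  have hMt : M ≠ ⊤ := ENNReal.rpow_ne_top_of_nonneg (by positivity) hfin
  have hMN : M ^ q = N := by
    rw [hM, ← ENNReal.rpow_mul, one_div_mul_cancel hq0.ne', ENNReal.rpow_one]
  have hpt : ∀ y ∈ B, ‖f y - m‖ₑ ^ q ≤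
      (2 * C) ^ q * (M ^ (q - p) * ∫⁻ z in B, W y z) := by
    intro y hy
    have hmeas : Measurable fun z => ‖f y - f z‖ₑ := (measurable_const.sub hf).enorm
    have hmono : ∀ (x' : EuclideanSpace ℝ (Fin n)) (t : ℝ), 0 < t → Metric.ball x' t ⊆ B →
        (∀ z ∈ Metric.ball x' t, dist y z ≤ 4 * t) →
        ∫⁻ z in Metric.ball x' t, ‖f y - f z‖ₑ ≤ volume (Metric.ball x' t) *
        (C₁ * (ENNReal.ofReal t ^ (n / p - n / q) * (∫⁻ z in B, W y z) ^ (1 / p))) := by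
      intro x' t ht hsub hdist
      refine (H x' t ht _ (W y) hmeas fun z hz => ?_).trans ?_
      · refine (hW y hy z (hsub hz)).trans ?_
        gcongr
        exact hdist z hz
      · gcongr
    have hg : ((∫⁻ z in B, W y z) ^ (1 / p)) ^ p = ∫⁻ z in B, W y z := by
      rw [← ENNReal.rpow_mul, one_div_mul_cancel hp0.ne', ENNReal.rpow_one]
    rw [← hg]
    refine rpow_le_of_interpolation hn hp hpq (R := ENNReal.ofReal (r / 2)) hC1 hM0 hMt ?_ ?_
    -- Small scales: average |f(y) - m| ≤ |f(y) - f(z)| + |f(z) - m| over z in a ball of radius t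
    -- inside B and near y. The first term gives the energy, the second the L^q norm by Hölder.
    · intro T hT0 hTR
      have hTt : T ≠ ⊤ := ne_top_of_le_ne_top ENNReal.ofReal_ne_top hTR
      obtain ⟨t, ht0, rfl⟩ : ∃ t, 0 ≤ t ∧ T = ENNReal.ofReal t :=
        ⟨T.toReal, ENNReal.toReal_nonneg, (ENNReal.ofReal_toReal hTt).symm⟩
      have ht : 0 < t := ht0.lt_of_ne (by rintro rfl; simp at hT0)
      have htr : t ≤ r / 2 := (ENNReal.ofReal_le_ofReal_iff (by positivity)).1 hTR
      obtain ⟨y', hy1, hy2⟩ := exists_ball_subset_ball_of_mem_ball hy ht htr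
      set V := volume (Metric.ball y' t) with hV
      have hV0 : V ≠ 0 := (Metric.measure_ball_pos _ _ ht).ne'
      have hVt : V ≠ ⊤ := measure_ball_lt_top.ne
      have h1 := hmono y' t ht hy1 fun z hz => by
        rw [dist_comm]; exact (Metric.mem_ball.1 (hy2 hz)).le
      have h2 : ∫⁻ z in Metric.ball y' t, ‖f z - m‖ₑ ≤ V * (V ^ (-(1 / q)) * M) := by
        have := lintegral_le_measure_univ_rpow_mul
          (μ := volume.restrict (Metric.ball y' t)) (hp.trans hpq)
          (F := fun z => ‖f z - m‖ₑ) (hf.sub_const m).enorm.aemeasurable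
        rw [Measure.restrict_apply_univ, sub_eq_add_neg, ENNReal.rpow_add _ _ hV0 hVt,
          ENNReal.rpow_one, mul_assoc] at this
        refine this.trans ?_
        rw [hM, hN]
        gcongr
      have h3 : V * ‖f y - m‖ₑ ≤ V * (C * (ENNReal.ofReal t ^ (n / p - n / q) *
          (∫⁻ z in B, W y z) ^ (1 / p) + ENNReal.ofReal t ^ (-(n / q)) * M)) := by
        calc V * ‖f y - m‖ₑ = ∫⁻ z in Metric.ball y' t, ‖f y - m‖ₑ := by
              rw [setLIntegral_const, mul_comm]
          _ ≤ ∫⁻ z in Metric.ball y' t, (‖f y - f z‖ₑ + ‖f z - m‖ₑ) := by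
              refine lintegral_mono fun z => ?_
              rw [← sub_add_sub_cancel (f y) (f z) m]; exact enorm_add_le _ _
          _ = (∫⁻ z in Metric.ball y' t, ‖f y - f z‖ₑ) +
              ∫⁻ z in Metric.ball y' t, ‖f z - m‖ₑ := lintegral_add_left hmeas _
          _ ≤ _ := add_le_add h1 h2
          _ ≤ _ := by
            have hVq : V ^ (-(1 / q)) ≤ C * ENNReal.ofReal t ^ (-(n / q)) := by
              rw [hV, volume_ball_eq_rpow y' ht, ENNReal.mul_rpow_of_ne_top
                (ENNReal.rpow_ne_top_of_nonneg (by positivity) ENNReal.ofReal_ne_top) hv₁t,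
                ← ENNReal.rpow_mul, mul_comm, show (n : ℝ) * -(1 / q) = -(n / q) by ring]
              gcongr
            rw [← hV, ← mul_add, mul_add C, ← mul_assoc C (_ ^ (-(n / q)))]
            gcongr
      exact (ENNReal.mul_le_mul_iff_right hV0 hVt).1 h3
    · set V := volume B with hV
      have hV0 : V ≠ 0 := (Metric.measure_ball_pos _ _ hr).ne'
      have hVt : V ≠ ⊤ := measure_ball_lt_top.ne
      refine (ENNReal.mul_le_mul_iff_right hV0 hVt).1 ((hm y hy).trans ?_)
      have h1 := hmono x r hr subset_rfl fun z hz => by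
        have h1 := Metric.mem_ball.1 hy
        have h2 := Metric.mem_ball'.1 hz
        linarith [dist_triangle y x z]
      have h2 : ENNReal.ofReal r = 2 * ENNReal.ofReal (r / 2) := by
        rw [← ENNReal.ofReal_ofNat, ← ENNReal.ofReal_mul (by norm_num)]; congr 1; ring
      calc C₀ * ∫⁻ z in B, ‖f y - f z‖ₑ ≤ C₀ * (V * (C₁ * (ENNReal.ofReal r ^ (n / p - n / q) *
            (∫⁻ z in B, W y z) ^ (1 / p)))) := by gcongr
        _ = V * (C₀ * C₁ * 2 ^ (n / p - n / q) * (ENNReal.ofReal (r / 2) ^ (n / p - n / q) *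
            (∫⁻ z in B, W y z) ^ (1 / p))) := by
          rw [h2, ENNReal.mul_rpow_of_nonneg _ _ hα]; ring
        _ ≤ _ := by gcongr
  have hfinal : N ≤ (2 * C) ^ q * (M ^ (q - p) * ∫⁻ y in B, ∫⁻ z in B, W y z) := by
    rw [← lintegral_const_mul' _ _ (ENNReal.rpow_ne_top_of_nonneg (by linarith) hMt),
      ← lintegral_const_mul' _ _ (ENNReal.rpow_ne_top_of_nonneg hq0.le
        (ENNReal.mul_ne_top (by norm_num) hCt))]
    exact setLIntegral_mono' measurableSet_ball hpt
  -- Absorption: M^q = M^(q-p) M^p, and the factor M^(q-p) cancels because M is neither zero nor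
  -- infinite.
  have hMp : M ^ p ≤ (2 * C) ^ q * ∫⁻ y in B, ∫⁻ z in B, W y z := by
    have hz : M ^ (q - p) ≠ 0 := by simp [hM0, hMt]
    have hzt : M ^ (q - p) ≠ ⊤ := ENNReal.rpow_ne_top_of_nonneg (by linarith) hMt
    refine (ENNReal.mul_le_mul_iff_right hz hzt).1 ?_
    rw [← ENNReal.rpow_add _ _ hM0 hMt, sub_add_cancel, hMN]
    exact hfinal.trans (le_of_eq (by ring))
  calc N = (M ^ p) ^ (q / p) := by
        rw [← ENNReal.rpow_mul, mul_div_cancel₀ _ hp0.ne', hMN]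
    _ ≤ _ := ENNReal.rpow_le_rpow hMp (by positivity)
    _ = _ := ENNReal.mul_rpow_of_nonneg _ _ (by positivity)

/-! ### Distance to the boundary -/

section Geometry

variable {n : ℕ} {Ω : Set (EuclideanSpace ℝ (Fin n))} {x y : EuclideanSpace ℝ (Fin n)}

theorem bdryDist_le_add_dist (Ω : Set (EuclideanSpace ℝ (Fin n)))
    (x y : EuclideanSpace ℝ (Fin n)) : bdryDist Ω x ≤ bdryDist Ω y + dist x y :=
  Metric.infDist_le_infDist_add_dist

theorem bdryDist_nonneg : 0 ≤ bdryDist Ω x := Metric.infDist_nonneg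

theorem continuous_bdryDist (Ω : Set (EuclideanSpace ℝ (Fin n))) : Continuous (bdryDist Ω) :=
  Metric.continuous_infDist_pt _

theorem bdryDist_pos (hΩ : IsOpen Ω) (hfr : (frontier Ω).Nonempty) (hx : x ∈ Ω) :
    0 < bdryDist Ω x := by
  refine (isClosed_frontier.notMem_iff_infDist_pos hfr).1 fun h => ?_
  rw [hΩ.frontier_eq] at h
  exact h.2 hx

/-- A ball is connected, so if it met both Ω and its complement it would meet the frontier, at a
distance from x less than d(x). -/
theorem ball_bdryDist_subset (hΩ : IsOpen Ω) (hx : x ∈ Ω) : Metric.ball x (bdryDist Ω x) ⊆ Ω := by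
  rcases le_or_gt (bdryDist Ω x) 0 with h0 | h0
  · simp [Metric.ball_eq_empty.2 h0]
  by_contra hsub
  obtain ⟨z, hz, hzΩ⟩ := not_subset.1 hsub
  have hconn : IsPreconnected (Metric.ball x (bdryDist Ω x)) :=
    (convex_ball _ _).isPreconnected
  obtain ⟨w, hw, hwf⟩ : (Metric.ball x (bdryDist Ω x) ∩ frontier Ω).Nonempty := by
    by_contra hne
    rw [not_nonempty_iff_eq_empty] at hne
    obtain ⟨w, -, hw1, hw2⟩ := hconn (interior Ω) (closure Ω)ᶜ isOpen_interior
      isClosed_closure.isOpen_compl (fun w hw => by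
        by_contra hcon
        simp only [mem_union, mem_compl_iff, not_or, not_not] at hcon
        have hmem : w ∈ Metric.ball x (bdryDist Ω x) ∩ frontier Ω := ⟨hw, hcon.2, hcon.1⟩
        rw [hne] at hmem
        exact hmem)
      ⟨x, Metric.mem_ball_self h0, by rw [hΩ.interior_eq]; exact hx⟩
      ⟨z, hz, fun hzc => by
        have : z ∈ Metric.ball x (bdryDist Ω x) ∩ frontier Ω :=
          ⟨hz, hzc, fun h => hzΩ (interior_subset h)⟩
        rw [hne] at this
        exact this⟩
    exact hw2 (subset_closure (interior_subset hw1))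
  have := Metric.infDist_le_dist_of_mem (x := x) hwf
  rw [Metric.mem_ball, dist_comm] at hw
  exact absurd hw (not_lt.2 this)

/-- `Metric.infDist` to the empty set is 0, so the positivity of d on Ω rests on this. -/
theorem frontier_nonempty_of_isBounded (hn : 0 < n) (hne : Ω.Nonempty)
    (hb : Bornology.IsBounded Ω) : (frontier Ω).Nonempty := by
  have : Nonempty (Fin n) := ⟨⟨0, hn⟩⟩
  rw [nonempty_frontier_iff]
  refine ⟨hne, ?_⟩
  rintro rfl
  exact NormedSpace.unbounded_univ ℝ (EuclideanSpace ℝ (Fin n)) hb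

theorem exists_bdryDist_le (hb : Bornology.IsBounded Ω) (hfr : (frontier Ω).Nonempty) :
    ∃ M : ℝ, 1 ≤ M ∧ ∀ x ∈ Ω, bdryDist Ω x ≤ M := by
  obtain ⟨z, hz⟩ := hfr
  obtain ⟨R, hR⟩ := hb.subset_closedBall z
  refine ⟨max R 1, le_max_right _ _, fun x hx => ?_⟩
  exact (Metric.infDist_le_dist_of_mem hz).trans
    ((Metric.mem_closedBall.1 (hR hx)).trans (le_max_left _ _))

/-- A twentieth of the distance to the boundary. -/
noncomputable def coreRadius (Ω : Set (EuclideanSpace ℝ (Fin n)))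
    (x : EuclideanSpace ℝ (Fin n)) : ℝ := bdryDist Ω x / 20

theorem coreRadius_pos (hΩ : IsOpen Ω) (hfr : (frontier Ω).Nonempty) (hx : x ∈ Ω) :
    0 < coreRadius Ω x := div_pos (bdryDist_pos hΩ hfr hx) (by norm_num)

theorem ball_coreRadius_subset (x : EuclideanSpace ℝ (Fin n)) :
    Metric.ball x (coreRadius Ω x) ⊆ Metric.ball x (3 * coreRadius Ω x) :=
  Metric.ball_subset_ball (by unfold coreRadius; linarith [bdryDist_nonneg (Ω := Ω) (x := x)])

theorem closedBall_three_coreRadius_subset (hΩ : IsOpen Ω) (hfr : (frontier Ω).Nonempty)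
    (hx : x ∈ Ω) : Metric.closedBall x (3 * coreRadius Ω x) ⊆ Ω :=
  (Metric.closedBall_subset_ball (by unfold coreRadius; linarith [bdryDist_pos hΩ hfr hx])).trans
    (ball_bdryDist_subset hΩ hx)

theorem ball_three_coreRadius_subset (hΩ : IsOpen Ω) (hfr : (frontier Ω).Nonempty)
    (hx : x ∈ Ω) : Metric.ball x (3 * coreRadius Ω x) ⊆ Ω :=
  Metric.ball_subset_closedBall.trans (closedBall_three_coreRadius_subset hΩ hfr hx)

theorem bdryDist_bounds_of_mem_ball (hy : y ∈ Metric.ball x (3 * coreRadius Ω x)) :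
    17 / 20 * bdryDist Ω x ≤ bdryDist Ω y ∧ bdryDist Ω y ≤ 23 / 20 * bdryDist Ω x := by
  have h := Metric.mem_ball.1 hy
  have h1 := bdryDist_le_add_dist Ω x y
  have h2 := bdryDist_le_add_dist Ω y x
  rw [dist_comm x y] at h1
  unfold coreRadius at h
  constructor <;> linarith

end Geometry

/-! ### Averages against tents, Lipschitz in the centre -/

section Tent

variable {n : ℕ} {Ω : Set (EuclideanSpace ℝ (Fin n))} {x x' y : EuclideanSpace ℝ (Fin n)}
  {f : EuclideanSpace ℝ (Fin n) → ℝ}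

/-- The tent function supported in the ball of centre `x` and radius `coreRadius Ω x`. -/
noncomputable def tent (Ω : Set (EuclideanSpace ℝ (Fin n)))
    (x w : EuclideanSpace ℝ (Fin n)) : ℝ := max (coreRadius Ω x - dist w x) 0

/-- The average of `f` near `x`, weighted by the tent function. -/
noncomputable def tentAverage (Ω : Set (EuclideanSpace ℝ (Fin n)))
    (f : EuclideanSpace ℝ (Fin n) → ℝ) (x : EuclideanSpace ℝ (Fin n)) : ℝ :=
  (∫ w, tent Ω x w * f w) / ∫ w, tent Ω x w

theorem tent_nonneg (w : EuclideanSpace ℝ (Fin n)) : 0 ≤ tent Ω x w := le_max_right _ _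

theorem continuous_coreRadius (Ω : Set (EuclideanSpace ℝ (Fin n))) : Continuous (coreRadius Ω) :=
  (continuous_bdryDist Ω).div_const _

theorem continuous_tent_uncurry (Ω : Set (EuclideanSpace ℝ (Fin n))) :
    Continuous (Function.uncurry (tent Ω)) :=
  (((continuous_coreRadius Ω).comp continuous_fst).sub
    (continuous_snd.dist continuous_fst)).max continuous_const

theorem continuous_tent (x : EuclideanSpace ℝ (Fin n)) : Continuous (tent Ω x) :=
  (continuous_const.sub (continuous_id.dist continuous_const)).max continuous_const

theorem tent_le (w : EuclideanSpace ℝ (Fin n)) : tent Ω x w ≤ coreRadius Ω x :=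
  max_le (by linarith [dist_nonneg (x := w) (y := x)])
    (div_nonneg bdryDist_nonneg (by norm_num))

theorem tent_eq_zero {w : EuclideanSpace ℝ (Fin n)} (hw : w ∉ Metric.ball x (coreRadius Ω x)) :
    tent Ω x w = 0 := by
  rw [Metric.mem_ball, not_lt] at hw
  exact max_eq_right (by linarith)

/-- The reason for tents rather than indicators of balls: they depend on the centre in a Lipschitz
way, since the radius d/20 and the distance do. Averages can thus be differentiated along curves. -/
theorem abs_tent_sub_tent_le (w : EuclideanSpace ℝ (Fin n)) :
    |tent Ω x' w - tent Ω x w| ≤ 2 * dist x' x := by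
  refine (abs_max_sub_max_le_abs _ _ _).trans ?_
  have h1 := bdryDist_le_add_dist Ω x x'
  have h2 := bdryDist_le_add_dist Ω x' x
  have h3 := dist_triangle w x' x
  have h4 := dist_triangle w x x'
  have h5 : 0 ≤ dist x' x := dist_nonneg
  rw [dist_comm x x'] at h1 h4
  unfold coreRadius
  rw [abs_le]
  constructor <;> linarith

theorem support_tent_mul_subset (g : EuclideanSpace ℝ (Fin n) → ℝ) :
    Function.support (fun w => tent Ω x w * g w) ⊆ Metric.closedBall x (coreRadius Ω x) := by
  intro w hw
  by_contra h
  exact hw (by simp [tent_eq_zero fun h' => h (Metric.ball_subset_closedBall h')])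

theorem integrable_tent_mul {g : EuclideanSpace ℝ (Fin n) → ℝ}
    (hg : ContinuousOn g (Metric.closedBall x (coreRadius Ω x))) :
    Integrable fun w => tent Ω x w * g w :=
  (integrableOn_iff_integrable_of_support_subset (support_tent_mul_subset g)).1
    (((continuous_tent x).continuousOn.mul hg).integrableOn_compact (isCompact_closedBall _ _))

theorem integrable_tent (x : EuclideanSpace ℝ (Fin n)) : Integrable (tent Ω x) := by
  simpa using integrable_tent_mul (Ω := Ω) (x := x) (g := fun _ => (1 : ℝ)) continuousOn_const

theorem ofReal_half_mul_volume_le_integral_tent {ρ : ℝ}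
    (hx : ρ ≤ coreRadius Ω x) :
    ENNReal.ofReal (ρ / 2) * volume (Metric.ball x (ρ / 2)) ≤
      ENNReal.ofReal (∫ w, tent Ω x w) := by
  rw [ofReal_integral_eq_lintegral_ofReal (integrable_tent x)
    (Filter.Eventually.of_forall fun w => tent_nonneg w)]
  calc _ = ∫⁻ w in Metric.ball x (ρ / 2), ENNReal.ofReal (ρ / 2) :=
        (setLIntegral_const _ _).symm
    _ ≤ ∫⁻ w in Metric.ball x (ρ / 2), ENNReal.ofReal (tent Ω x w) := by
        refine setLIntegral_mono' measurableSet_ball fun w hw => ?_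
        refine ENNReal.ofReal_le_ofReal (le_trans ?_ (le_max_left _ _))
        have := Metric.mem_ball.1 hw
        linarith
    _ ≤ _ := setLIntegral_le_lintegral _ _

theorem integral_tent_pos (hx : 0 < coreRadius Ω x) : 0 < ∫ w, tent Ω x w := by
  have h := ofReal_half_mul_volume_le_integral_tent (Ω := Ω) (x := x) le_rfl
  have h0 : ENNReal.ofReal (coreRadius Ω x / 2) *
      volume (Metric.ball x (coreRadius Ω x / 2)) ≠ 0 :=
    mul_ne_zero (by simpa using hx) (Metric.measure_ball_pos _ _ (by positivity)).ne'
  by_contra hneg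
  rw [ENNReal.ofReal_of_nonpos (not_lt.1 hneg)] at h
  exact h0 (le_antisymm h zero_le)

/-- The constant c is free: c = f(y) compares f with its average, and c = A(x) makes the integral
against the tent at x vanish. -/
theorem integral_tent_mul_sub_tentAverage
    (hx : 0 < coreRadius Ω x) (hf : ContinuousOn f (Metric.closedBall x (coreRadius Ω x)))
    (c : ℝ) : ∫ w, tent Ω x w * (f w - c) = (∫ w, tent Ω x w) * (tentAverage Ω f x - c) := by
  have hZ := (integral_tent_pos hx).ne'
  simp_rw [mul_sub]
  rw [integral_sub (integrable_tent_mul hf) ((integrable_tent x).mul_const c),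
    integral_mul_const, tentAverage, mul_div_cancel₀ _ hZ]

theorem volume_ball_div {ρ k : ℝ} (hρ : 0 < ρ) (hk : 0 < k) (x y : EuclideanSpace ℝ (Fin n)) :
    volume (Metric.ball x ρ) = ENNReal.ofReal k ^ (n : ℝ) * volume (Metric.ball y (ρ / k)) := by
  rw [volume_ball_eq_rpow _ hρ, volume_ball_eq_rpow _ (div_pos hρ hk), ← mul_assoc,
    ← ENNReal.mul_rpow_of_nonneg _ _ (by positivity), ← ENNReal.ofReal_mul hk.le,
    mul_div_cancel₀ _ hk.ne']

/-- The tent is at most r, while its integral is at least r/2 times the volume of the half ball;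
this ratio gives 2^(n+1). -/
theorem volume_ball_mul_enorm_sub_tentAverage_le
    (hx : 0 < coreRadius Ω x) (hf : ContinuousOn f (Metric.closedBall x (coreRadius Ω x)))
    (y : EuclideanSpace ℝ (Fin n)) :
    volume (Metric.ball x (coreRadius Ω x)) * ‖f y - tentAverage Ω f x‖ₑ ≤
      2 ^ ((n : ℝ) + 1) * ∫⁻ z in Metric.ball x (coreRadius Ω x), ‖f y - f z‖ₑ := by
  set r := coreRadius Ω x with hr
  set Z := ∫ w, tent Ω x w with hZ
  have hZ0 : 0 < Z := integral_tent_pos hx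
  have h1 : ENNReal.ofReal Z * ‖f y - tentAverage Ω f x‖ₑ ≤
      ENNReal.ofReal r * ∫⁻ z in Metric.ball x r, ‖f y - f z‖ₑ := by
    have e : ENNReal.ofReal Z * ‖f y - tentAverage Ω f x‖ₑ =
        ‖∫ w, tent Ω x w * (f w - f y)‖ₑ := by
      rw [integral_tent_mul_sub_tentAverage hx hf, enorm_mul, Real.enorm_of_nonneg hZ0.le,
        enorm_sub_rev]
    rw [e, ← lintegral_const_mul' _ _ ENNReal.ofReal_ne_top]
    refine (enorm_integral_le_lintegral_enorm _).trans ?_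
    rw [← lintegral_indicator measurableSet_ball]
    refine lintegral_mono fun w => ?_
    by_cases hw : w ∈ Metric.ball x r
    · rw [indicator_of_mem hw, enorm_mul, Real.enorm_of_nonneg (tent_nonneg w), enorm_sub_rev]
      gcongr
      exact tent_le w
    · simp [tent_eq_zero hw]
  have h2 := ofReal_half_mul_volume_le_integral_tent (Ω := Ω) (x := x) le_rfl
  have hr0 : ENNReal.ofReal (r / 2) ≠ 0 := by simpa using hx
  refine (ENNReal.mul_le_mul_iff_right hr0 ENNReal.ofReal_ne_top).1 ?_
  have e2 : ENNReal.ofReal r = 2 * ENNReal.ofReal (r / 2) := by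
    rw [← ENNReal.ofReal_ofNat, ← ENNReal.ofReal_mul (by norm_num)]; congr 1; ring
  calc ENNReal.ofReal (r / 2) * (volume (Metric.ball x r) * ‖f y - tentAverage Ω f x‖ₑ)
      = 2 ^ (n : ℝ) * ((ENNReal.ofReal (r / 2) * volume (Metric.ball x (r / 2))) *
          ‖f y - tentAverage Ω f x‖ₑ) := by
        rw [volume_ball_div hx (k := 2) (by norm_num) x x, ENNReal.ofReal_ofNat]; ring
    _ ≤ 2 ^ (n : ℝ) * (ENNReal.ofReal Z * ‖f y - tentAverage Ω f x‖ₑ) := by gcongr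
    _ ≤ 2 ^ (n : ℝ) * (ENNReal.ofReal r * ∫⁻ z in Metric.ball x r, ‖f y - f z‖ₑ) := by gcongr
    _ = _ := by
      rw [e2, ENNReal.rpow_add _ _ (by norm_num) (by norm_num), ENNReal.rpow_one]; ring

/-- Since f - A(x) has zero mean against the tent at x, the difference of averages is the integral
of f - A(x) against the difference of two tents, which is O(|x' - x|). Both tents are supported in
the tripled ball: the one at x' has radius at most 3r/2. -/
theorem volume_ball_mul_enorm_tentAverage_sub_le
    (hx : 0 < coreRadius Ω x) (hf : ContinuousOn f (Metric.closedBall x (3 * coreRadius Ω x)))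
    (hx' : dist x' x ≤ coreRadius Ω x) :
    ENNReal.ofReal (coreRadius Ω x) * volume (Metric.ball x (coreRadius Ω x)) *
        ‖tentAverage Ω f x' - tentAverage Ω f x‖ₑ ≤
      4 ^ ((n : ℝ) + 2) * ENNReal.ofReal (dist x' x) *
        ∫⁻ w in Metric.ball x (3 * coreRadius Ω x), ‖f w - tentAverage Ω f x‖ₑ := by
  set r := coreRadius Ω x with hr
  have hr1 := bdryDist_le_add_dist Ω x x'
  have hr2 := bdryDist_le_add_dist Ω x' x
  rw [dist_comm x x'] at hr1
  have hr1' : r / 2 ≤ coreRadius Ω x' := by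
    unfold coreRadius at hr ⊢; linarith
  have hr2' : coreRadius Ω x' ≤ 2 * r - r / 2 := by
    unfold coreRadius at hr ⊢; linarith
  have hx'0 : 0 < coreRadius Ω x' := by linarith
  have hsub : Metric.closedBall x' (coreRadius Ω x') ⊆ Metric.closedBall x (3 * r) :=
    Metric.closedBall_subset_closedBall' (by linarith)
  have hsubx : Metric.closedBall x r ⊆ Metric.closedBall x (3 * r) :=
    Metric.closedBall_subset_closedBall (by linarith)
  set Z := ∫ w, tent Ω x' w with hZ
  have hZ0 : 0 < Z := integral_tent_pos hx'0
  set A := tentAverage Ω f x with hA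
  have h1 : ENNReal.ofReal Z * ‖tentAverage Ω f x' - A‖ₑ ≤
      2 * ENNReal.ofReal (dist x' x) * ∫⁻ w in Metric.ball x (3 * r), ‖f w - A‖ₑ := by
    have e : ENNReal.ofReal Z * ‖tentAverage Ω f x' - A‖ₑ =
        ‖∫ w, (tent Ω x' w - tent Ω x w) * (f w - A)‖ₑ := by
      simp_rw [sub_mul]
      rw [integral_sub (integrable_tent_mul (g := fun w => f w - A)
          ((hf.mono hsub).sub continuousOn_const))
        (integrable_tent_mul (g := fun w => f w - A) ((hf.mono hsubx).sub continuousOn_const)),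
        integral_tent_mul_sub_tentAverage hx'0 (hf.mono hsub),
        integral_tent_mul_sub_tentAverage hx (hf.mono hsubx), ← hA, sub_self, mul_zero, sub_zero,
        enorm_mul, Real.enorm_of_nonneg hZ0.le]
    rw [e, ← lintegral_const_mul' _ _ (ENNReal.mul_ne_top (by norm_num) ENNReal.ofReal_ne_top)]
    refine (enorm_integral_le_lintegral_enorm _).trans ?_
    rw [← lintegral_indicator measurableSet_ball]
    refine lintegral_mono fun w => ?_
    by_cases hw : w ∈ Metric.ball x (3 * r)
    · rw [indicator_of_mem hw, enorm_mul]
      gcongr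
      rw [Real.enorm_eq_ofReal_abs]
      refine (ENNReal.ofReal_le_ofReal (abs_tent_sub_tent_le w)).trans (le_of_eq ?_)
      rw [ENNReal.ofReal_mul (by norm_num), ENNReal.ofReal_ofNat]
    · have hw1 : w ∉ Metric.ball x (coreRadius Ω x) := fun h =>
        hw (Metric.ball_subset_ball (by linarith) h)
      have hw2 : w ∉ Metric.ball x' (coreRadius Ω x') := fun h =>
        hw (Metric.ball_subset_ball' (by linarith) h)
      simp [tent_eq_zero hw1, tent_eq_zero hw2]
  have h2 := ofReal_half_mul_volume_le_integral_tent hr1'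
  have e2 : ENNReal.ofReal r = 4 * ENNReal.ofReal (r / 2 / 2) := by
    rw [← ENNReal.ofReal_ofNat, ← ENNReal.ofReal_mul (by norm_num)]; congr 1; ring
  calc ENNReal.ofReal r * volume (Metric.ball x r) * ‖tentAverage Ω f x' - A‖ₑ
      = 4 ^ ((n : ℝ) + 1) * ((ENNReal.ofReal (r / 2 / 2) * volume (Metric.ball x' (r / 2 / 2))) *
          ‖tentAverage Ω f x' - A‖ₑ) := by
        rw [volume_ball_div hx (k := 4) (by norm_num) x x', ENNReal.ofReal_ofNat, e2,
          show r / 4 = r / 2 / 2 by ring,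
          ENNReal.rpow_add _ _ (by norm_num) (by norm_num), ENNReal.rpow_one]; ring
    _ ≤ 4 ^ ((n : ℝ) + 1) * (ENNReal.ofReal Z * ‖tentAverage Ω f x' - A‖ₑ) := by gcongr
    _ ≤ 4 ^ ((n : ℝ) + 1) * (2 * ENNReal.ofReal (dist x' x) *
          ∫⁻ w in Metric.ball x (3 * r), ‖f w - A‖ₑ) := by gcongr
    _ ≤ 4 ^ ((n : ℝ) + 1) * (4 * ENNReal.ofReal (dist x' x) *
          ∫⁻ w in Metric.ball x (3 * r), ‖f w - A‖ₑ) := by gcongr; norm_num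
    _ = _ := by
      rw [show (n : ℝ) + 2 = n + 1 + 1 by ring,
        ENNReal.rpow_add (n + 1 : ℝ) _ (by norm_num) (by norm_num), ENNReal.rpow_one]; ring

/-- The total oscillation of `f` near `x`. -/
noncomputable def coreOsc (Ω : Set (EuclideanSpace ℝ (Fin n)))
    (f : EuclideanSpace ℝ (Fin n) → ℝ) (x : EuclideanSpace ℝ (Fin n)) : ℝ≥0∞ :=
  ∫⁻ w in Metric.ball x (3 * coreRadius Ω x), ∫⁻ z in Metric.ball x (coreRadius Ω x),
    ‖f w - f z‖ₑ

theorem volume_sq_mul_enorm_tentAverage_sub_le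
    (hx : 0 < coreRadius Ω x) (hf : ContinuousOn f (Metric.closedBall x (3 * coreRadius Ω x)))
    (hx' : dist x' x ≤ coreRadius Ω x) :
    ENNReal.ofReal (coreRadius Ω x) * volume (Metric.ball x (coreRadius Ω x)) ^ 2 *
        ‖tentAverage Ω f x' - tentAverage Ω f x‖ₑ ≤
      8 ^ ((n : ℝ) + 2) * ENNReal.ofReal (dist x' x) * coreOsc Ω f x := by
  have hsubx : Metric.closedBall x (coreRadius Ω x) ⊆ Metric.closedBall x (3 * coreRadius Ω x) :=
    Metric.closedBall_subset_closedBall (by linarith)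
  have h1 := volume_ball_mul_enorm_tentAverage_sub_le hx hf hx'
  set V := volume (Metric.ball x (coreRadius Ω x)) with hV
  have hVt : V ≠ ⊤ := measure_ball_lt_top.ne
  have h2 : V * ∫⁻ w in Metric.ball x (3 * coreRadius Ω x), ‖f w - tentAverage Ω f x‖ₑ ≤
      2 ^ ((n : ℝ) + 1) * coreOsc Ω f x := by
    rw [coreOsc, ← lintegral_const_mul' _ _ hVt, ← lintegral_const_mul' _ _
      (ENNReal.rpow_ne_top_of_nonneg (by positivity) (by norm_num))]
    exact lintegral_mono fun w => volume_ball_mul_enorm_sub_tentAverage_le hx (hf.mono hsubx) w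
  calc _ = V * (ENNReal.ofReal (coreRadius Ω x) * V *
        ‖tentAverage Ω f x' - tentAverage Ω f x‖ₑ) := by ring
    _ ≤ V * (4 ^ ((n : ℝ) + 2) * ENNReal.ofReal (dist x' x) *
        ∫⁻ w in Metric.ball x (3 * coreRadius Ω x), ‖f w - tentAverage Ω f x‖ₑ) := by gcongr
    _ = 4 ^ ((n : ℝ) + 2) * ENNReal.ofReal (dist x' x) * (V *
        ∫⁻ w in Metric.ball x (3 * coreRadius Ω x), ‖f w - tentAverage Ω f x‖ₑ) := by ring
    _ ≤ 4 ^ ((n : ℝ) + 2) * ENNReal.ofReal (dist x' x) *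
        (2 ^ ((n : ℝ) + 2) * coreOsc Ω f x) := by
      refine mul_le_mul_right (h2.trans ?_) _
      gcongr <;> norm_num
    _ = _ := by
      rw [show (8 : ℝ≥0∞) = 4 * 2 by norm_num, ENNReal.mul_rpow_of_nonneg _ _ (by positivity)]
      ring

end Tent

/-! ### Local energies and the Lipschitz bound for averages -/

section Kernel

variable {n : ℕ} {Ω : Set (EuclideanSpace ℝ (Fin n))} {x y : EuclideanSpace ℝ (Fin n)}
  {f : EuclideanSpace ℝ (Fin n) → ℝ} {s p q b : ℝ}

/-- The integrand of the weighted fractional seminorm. -/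
noncomputable def fracKernel (Ω : Set (EuclideanSpace ℝ (Fin n))) (s p b : ℝ)
    (f : EuclideanSpace ℝ (Fin n) → ℝ) (x z : EuclideanSpace ℝ (Fin n)) : ℝ≥0∞ :=
  ENNReal.ofReal (|f z - f x| ^ p / ‖z - x‖ ^ ((n : ℝ) + s * p) * minBdryDist Ω x z ^ b)

/-- The inner integral of the weighted fractional seminorm. -/
noncomputable def fracEnergy (Ω : Set (EuclideanSpace ℝ (Fin n))) (s p b : ℝ)
    (f : EuclideanSpace ℝ (Fin n) → ℝ) (x : EuclideanSpace ℝ (Fin n)) : ℝ≥0∞ :=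
  ∫⁻ z in {z | z ∈ Ω ∧ ‖x - z‖ ≤ bdryDist Ω x / 2}, fracKernel Ω s p b f x z

/-- The energy of `f` near `x`. -/
noncomputable def coreEnergy (Ω : Set (EuclideanSpace ℝ (Fin n))) (s p b : ℝ)
    (f : EuclideanSpace ℝ (Fin n) → ℝ) (x : EuclideanSpace ℝ (Fin n)) : ℝ≥0∞ :=
  ∫⁻ w in Metric.ball x (3 * coreRadius Ω x), fracEnergy Ω s p b f w

theorem measurable_fracKernel (hf : Measurable f) :
    Measurable (Function.uncurry (fracKernel Ω s p b f)) := by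
  have hd : Measurable (bdryDist Ω) := (continuous_bdryDist Ω).measurable
  refine Measurable.ennreal_ofReal (Measurable.mul (Measurable.div ?_ ?_) ?_)
  · exact (((hf.comp measurable_snd).sub (hf.comp measurable_fst)).abs).pow_const _
  · exact ((measurable_snd.sub measurable_fst).norm).pow_const _
  · exact ((hd.comp measurable_fst).min (hd.comp measurable_snd)).pow_const _

theorem measurable_setLIntegral_of_measurableSet {α β : Type*} [MeasurableSpace α]
    [MeasurableSpace β] {μ : Measure β} [SFinite μ] {S : Set (α × β)} (hS : MeasurableSet S)
    {F : α × β → ℝ≥0∞} (hF : Measurable F) :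
    Measurable fun x => ∫⁻ z in {z | (x, z) ∈ S}, F (x, z) ∂μ := by
  have : ∀ x, ∫⁻ z in {z | (x, z) ∈ S}, F (x, z) ∂μ = ∫⁻ z, S.indicator F (x, z) ∂μ := by
    intro x
    rw [← lintegral_indicator (show MeasurableSet {z | (x, z) ∈ S} from
      measurable_prodMk_left hS)]
    rfl
  simp_rw [this]
  exact (hF.indicator hS).lintegral_prod_right'

theorem measurable_fracEnergy (hΩ : IsOpen Ω) (hf : Measurable f) :
    Measurable (fracEnergy Ω s p b f) := by
  refine measurable_setLIntegral_of_measurableSet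
    (S := {a | a.2 ∈ Ω ∧ ‖a.1 - a.2‖ ≤ bdryDist Ω a.1 / 2}) ?_ (measurable_fracKernel hf)
  have h1 : Measurable fun a : EuclideanSpace ℝ (Fin n) × EuclideanSpace ℝ (Fin n) =>
      ‖a.1 - a.2‖ := (measurable_fst.sub measurable_snd).norm
  have h2 : Measurable fun a : EuclideanSpace ℝ (Fin n) × EuclideanSpace ℝ (Fin n) =>
      bdryDist Ω a.1 / 2 :=
    ((continuous_bdryDist Ω).measurable.comp measurable_fst).div_const _
  have h3 := measurableSet_le h1 h2
  exact (hΩ.measurableSet.preimage measurable_snd).inter h3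

theorem measurable_coreEnergy (hΩ : IsOpen Ω) (hf : Measurable f) :
    Measurable (coreEnergy Ω s p b f) := by
  refine measurable_setLIntegral_of_measurableSet
    (S := {a | dist a.2 a.1 < 3 * coreRadius Ω a.1}) ?_
    ((measurable_fracEnergy hΩ hf).comp measurable_snd)
  exact measurableSet_lt (measurable_snd.dist measurable_fst)
    (((continuous_coreRadius Ω).measurable.comp measurable_fst).const_mul _)

theorem coreEnergy_le (hΩ : IsOpen Ω) (hfr : (frontier Ω).Nonempty) (hx : x ∈ Ω) :
    coreEnergy Ω s p b f x ≤ ∫⁻ w in Ω, fracEnergy Ω s p b f w :=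
  lintegral_mono_set (ball_three_coreRadius_subset hΩ hfr hx)

theorem ofReal_bdryDist_ne_zero (hΩ : IsOpen Ω) (hfr : (frontier Ω).Nonempty) (hx : x ∈ Ω) :
    ENNReal.ofReal (bdryDist Ω x) ≠ 0 := by
  simpa using bdryDist_pos hΩ hfr hx

theorem ofReal_bdryDist_le_two_mul (h : bdryDist Ω x ≤ 2 * bdryDist Ω y) :
    ENNReal.ofReal (bdryDist Ω x) ≤ 2 * ENNReal.ofReal (bdryDist Ω y) := by
  refine (ENNReal.ofReal_le_ofReal h).trans (le_of_eq ?_)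
  rw [ENNReal.ofReal_mul (by norm_num), ENNReal.ofReal_ofNat]

/-- Near x the weight is comparable to d(x), and |w - z| ≤ d(x), so any surplus n + sp - e ≥ 0 of
powers of |w - z| can be traded for powers of d(x). The case e = 0 serves the averages, e = 2n -
np/q the Sobolev–Poincaré inequality. -/
theorem enorm_sub_rpow_le_fracKernel (hΩ : IsOpen Ω) (hfr : (frontier Ω).Nonempty) (hp : 0 < p)
    (hx : x ∈ Ω) {w z : EuclideanSpace ℝ (Fin n)} {e : ℝ} (he : e ≤ n + s * p)
    (hw : w ∈ Metric.ball x (3 * coreRadius Ω x)) (hz : z ∈ Metric.ball x (3 * coreRadius Ω x)) :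
    ‖f w - f z‖ₑ ^ p ≤ ENNReal.ofReal (dist w z) ^ e *
      (2 ^ |b| * ENNReal.ofReal (bdryDist Ω x) ^ (n + s * p - e - b) * fracKernel Ω s p b f w z) := by
  rcases eq_or_ne w z with rfl | hwz
  · simp [hp]
  have hd := bdryDist_pos hΩ hfr hx
  obtain ⟨hw1, hw2⟩ := bdryDist_bounds_of_mem_ball hw
  obtain ⟨hz1, hz2⟩ := bdryDist_bounds_of_mem_ball hz
  have ht : 0 < dist w z := dist_pos.2 hwz
  have htd : dist w z ≤ bdryDist Ω x := by
    have h1 := Metric.mem_ball.1 hw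
    have h2 := Metric.mem_ball'.1 hz
    unfold coreRadius at h1 h2
    linarith [dist_triangle w x z]
  have hδ1 : bdryDist Ω x ≤ 2 * minBdryDist Ω w z := by
    have : bdryDist Ω x / 2 ≤ minBdryDist Ω w z := le_min (by linarith) (by linarith)
    linarith
  have hδ2 : minBdryDist Ω w z ≤ 2 * bdryDist Ω x := (min_le_left _ _).trans (by linarith)
  have hδ : 0 < minBdryDist Ω w z := by linarith
  set D := ENNReal.ofReal (bdryDist Ω x) with hD
  set T := ENNReal.ofReal (dist w z) with hT
  set Δ := ENNReal.ofReal (minBdryDist Ω w z) with hΔ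
  have hD0 : D ≠ 0 := by simpa [hD] using hd
  have hT0 : T ≠ 0 := by simpa [hT] using ht
  have hDt : D ≠ ⊤ := ENNReal.ofReal_ne_top
  have hTt : T ≠ ⊤ := ENNReal.ofReal_ne_top
  have hk : fracKernel Ω s p b f w z = ‖f w - f z‖ₑ ^ p * T ^ (-(n + s * p)) * Δ ^ b := by
    rw [fracKernel, ENNReal.ofReal_mul (by positivity), div_eq_mul_inv,
      ENNReal.ofReal_mul (by positivity), ← Real.rpow_neg (norm_nonneg _), ← dist_eq_norm,
      dist_comm z w, enorm_sub_rev, Real.enorm_eq_ofReal_abs,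
      ENNReal.ofReal_rpow_of_nonneg (abs_nonneg _) hp.le, ENNReal.ofReal_rpow_of_pos ht,
      ENNReal.ofReal_rpow_of_pos hδ]
  have h1 : 1 ≤ 2 ^ |b| * D ^ (-b) * Δ ^ b := by
    have := ENNReal.rpow_le_mul_rpow_of_le_of_le (c := 2) (x := D) (y := Δ) (by norm_num)
      (by norm_num) (by rw [hD, hΔ, ← ENNReal.ofReal_ofNat, ← ENNReal.ofReal_mul (by norm_num)]
                        exact ENNReal.ofReal_le_ofReal hδ1)
      (by rw [hD, hΔ, ← ENNReal.ofReal_ofNat, ← ENNReal.ofReal_mul (by norm_num)]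
          exact ENNReal.ofReal_le_ofReal hδ2) b
    calc (1 : ℝ≥0∞) = D ^ (-b) * D ^ b := by
          rw [← ENNReal.rpow_add _ _ hD0 hDt]; simp
      _ ≤ D ^ (-b) * (2 ^ |b| * Δ ^ b) := by gcongr
      _ = _ := by ring
  have h2 : 1 ≤ D ^ (n + s * p - e) * T ^ (e - (n + s * p)) := by
    calc (1 : ℝ≥0∞) = T ^ (n + s * p - e) * T ^ (e - (n + s * p)) := by
          rw [← ENNReal.rpow_add _ _ hT0 hTt]; simp
      _ ≤ _ := by
        exact mul_le_mul_left (ENNReal.rpow_le_rpow (ENNReal.ofReal_le_ofReal htd)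
          (by linarith)) _
  calc ‖f w - f z‖ₑ ^ p = ‖f w - f z‖ₑ ^ p * (1 * 1) := by simp
    _ ≤ ‖f w - f z‖ₑ ^ p * ((2 ^ |b| * D ^ (-b) * Δ ^ b) *
        (D ^ (n + s * p - e) * T ^ (e - (n + s * p)))) := by gcongr
    _ = _ := by
      rw [hk, sub_eq_add_neg _ b, ENNReal.rpow_add _ _ hD0 hDt, sub_eq_add_neg e,
        ENNReal.rpow_add _ _ hT0 hTt]
      ring

/-- The radius d/20 is chosen for this: |w - z| < 4d(x)/20, while d(w)/2 ≥ 17d(x)/40, so the pair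
lies in the domain of the seminorm. -/
theorem setLIntegral_fracKernel_le_fracEnergy (hΩ : IsOpen Ω) (hfr : (frontier Ω).Nonempty)
    (hx : x ∈ Ω) {w : EuclideanSpace ℝ (Fin n)} (hw : w ∈ Metric.ball x (3 * coreRadius Ω x)) :
    ∫⁻ z in Metric.ball x (coreRadius Ω x), fracKernel Ω s p b f w z ≤
      fracEnergy Ω s p b f w := by
  refine lintegral_mono_set fun z hz => ⟨ball_three_coreRadius_subset hΩ hfr hx
    (ball_coreRadius_subset x hz), ?_⟩
  have hd := bdryDist_pos hΩ hfr hx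
  have h0 := (bdryDist_bounds_of_mem_ball hw).1
  have h1 := Metric.mem_ball.1 hw
  have h2 := Metric.mem_ball'.1 hz
  unfold coreRadius at h1 h2
  rw [← dist_eq_norm]
  linarith [dist_triangle w x z]

theorem volume_ball_mul_bdryDist (hΩ : IsOpen Ω) (hfr : (frontier Ω).Nonempty) (hx : x ∈ Ω)
    (y : EuclideanSpace ℝ (Fin n)) {k : ℝ} (hk : 0 < k) :
    volume (Metric.ball y (k * bdryDist Ω x)) =
      ENNReal.ofReal k ^ (n : ℝ) * volume (Metric.ball (0 : EuclideanSpace ℝ (Fin n)) 1) *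
        ENNReal.ofReal (bdryDist Ω x) ^ (n : ℝ) := by
  rw [volume_ball_eq_rpow _ (mul_pos hk (bdryDist_pos hΩ hfr hx)), ENNReal.ofReal_mul hk.le,
    ENNReal.mul_rpow_of_nonneg _ _ (by positivity)]
  ring

theorem exists_volume_ball_eq (n : ℕ) {k : ℝ} (hk : 0 < k) : ∃ K : ℝ≥0∞, K ≠ 0 ∧ K ≠ ⊤ ∧
    ∀ (Ω : Set (EuclideanSpace ℝ (Fin n))) (_ : IsOpen Ω) (_ : (frontier Ω).Nonempty),
      ∀ x ∈ Ω, ∀ y : EuclideanSpace ℝ (Fin n), volume (Metric.ball y (k * bdryDist Ω x)) =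
        K * ENNReal.ofReal (bdryDist Ω x) ^ (n : ℝ) := by
  refine ⟨_, ?_, ?_, fun Ω hΩ hfr x hx y => volume_ball_mul_bdryDist hΩ hfr hx y hk⟩
  · have : ENNReal.ofReal k ^ (n : ℝ) ≠ 0 := by simp [hk]
    exact mul_ne_zero this (Metric.measure_ball_pos _ _ one_pos).ne'
  · exact ENNReal.mul_ne_top (ENNReal.rpow_ne_top_of_nonneg (by positivity) ENNReal.ofReal_ne_top)
      measure_ball_lt_top.ne

theorem exists_volume_ball_coreRadius_eq (n : ℕ) : ∃ K : ℝ≥0∞, K ≠ 0 ∧ K ≠ ⊤ ∧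
    ∀ (Ω : Set (EuclideanSpace ℝ (Fin n))) (_ : IsOpen Ω) (_ : (frontier Ω).Nonempty),
      ∀ x ∈ Ω, volume (Metric.ball x (coreRadius Ω x)) =
        K * ENNReal.ofReal (bdryDist Ω x) ^ (n : ℝ) := by
  obtain ⟨K, h0, ht, h⟩ := exists_volume_ball_eq n (k := 1 / 20) (by norm_num)
  refine ⟨K, h0, ht, fun Ω hΩ hfr x hx => ?_⟩
  rw [← h Ω hΩ hfr x hx x, coreRadius]
  congr 2; ring

theorem coreOsc_rpow_le (hΩ : IsOpen Ω) (hfr : (frontier Ω).Nonempty) (hp : 1 ≤ p) (hs : 0 ≤ s)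
    (hf : Measurable f) (hx : x ∈ Ω) :
    coreOsc Ω f x ^ p ≤ volume (Metric.ball x (3 * coreRadius Ω x)) ^ (p - 1) *
      volume (Metric.ball x (coreRadius Ω x)) ^ (p - 1) * (2 ^ |b| *
        ENNReal.ofReal (bdryDist Ω x) ^ (n + s * p - b)) * coreEnergy Ω s p b f x := by
  have hp0 : 0 < p := by linarith
  set V := volume (Metric.ball x (coreRadius Ω x)) with hV
  set V' := volume (Metric.ball x (3 * coreRadius Ω x)) with hV'
  set D := ENNReal.ofReal (bdryDist Ω x) with hD
  have hD0 : D ≠ 0 := ofReal_bdryDist_ne_zero hΩ hfr hx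
  have hDt : D ≠ ⊤ := ENNReal.ofReal_ne_top
  have hm : Measurable (Function.uncurry fun w z => ‖f w - f z‖ₑ) :=
    ((hf.comp measurable_fst).sub (hf.comp measurable_snd)).enorm
  have hm' : Measurable fun w => ∫⁻ z in Metric.ball x (coreRadius Ω x), ‖f w - f z‖ₑ :=
    hm.lintegral_prod_right'
  have hVt : V ^ (p - 1) ≠ ⊤ :=
    ENNReal.rpow_ne_top_of_nonneg (by linarith) measure_ball_lt_top.ne
  have hct : (2 : ℝ≥0∞) ^ |b| * D ^ (n + s * p - b) ≠ ⊤ :=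
    ENNReal.mul_ne_top (ENNReal.rpow_ne_top_of_nonneg (abs_nonneg _) (by norm_num))
      (by simp [hD0, hDt])
  have h1 := rpow_lintegral_le_measure_univ_rpow_mul
    (μ := volume.restrict (Metric.ball x (3 * coreRadius Ω x))) hp hm'.aemeasurable
  rw [Measure.restrict_apply_univ] at h1
  refine h1.trans ?_
  rw [mul_assoc, mul_assoc, coreEnergy]
  gcongr
  rw [← lintegral_const_mul' _ _ hct, ← lintegral_const_mul' _ _ hVt]
  refine setLIntegral_mono' measurableSet_ball fun w hw => ?_
  have h2 := rpow_lintegral_le_measure_univ_rpow_mul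
    (μ := volume.restrict (Metric.ball x (coreRadius Ω x))) hp
    (F := fun z => ‖f w - f z‖ₑ) (measurable_const.sub hf).enorm.aemeasurable
  rw [Measure.restrict_apply_univ] at h2
  refine h2.trans ?_
  gcongr
  calc _ ≤ ∫⁻ z in Metric.ball x (coreRadius Ω x),
        2 ^ |b| * D ^ (n + s * p - b) * fracKernel Ω s p b f w z := by
        refine setLIntegral_mono' measurableSet_ball fun z hz => ?_
        have := enorm_sub_rpow_le_fracKernel (f := f) (s := s) (b := b) (e := 0) hΩ hfr hp0 hx
          (by positivity) hw (ball_coreRadius_subset x hz)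
        simpa using this
    _ ≤ _ := by
      rw [lintegral_const_mul' _ _ hct]
      gcongr
      exact setLIntegral_fracKernel_le_fracEnergy hΩ hfr hx hw

/-- A gradient bound for the averages. The exponent comes from 2np - n + sp - b, produced by two
Hölder inequalities, less the p + 2np from the normalisation r |B|². -/
theorem exists_enorm_tentAverage_sub_rpow_le (n : ℕ) (hp : 1 ≤ p) (hs : 0 ≤ s) (b : ℝ) :
    ∃ C : ℝ≥0∞, C ≠ ⊤ ∧ ∀ (Ω : Set (EuclideanSpace ℝ (Fin n))) (_ : IsOpen Ω)
      (_ : (frontier Ω).Nonempty) (f : EuclideanSpace ℝ (Fin n) → ℝ) (_ : Measurable f)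
      (_ : ContinuousOn f Ω), ∀ x ∈ Ω, ∀ x', dist x' x ≤ coreRadius Ω x →
      ‖tentAverage Ω f x' - tentAverage Ω f x‖ₑ ^ p ≤ C * (ENNReal.ofReal (dist x' x) ^ p *
        (ENNReal.ofReal (bdryDist Ω x) ^ (s * p - p - n - b) * coreEnergy Ω s p b f x)) := by
  obtain ⟨K, hK0, hKt, hK⟩ := exists_volume_ball_coreRadius_eq n
  obtain ⟨K', hK'0, hK't, hK'⟩ := exists_volume_ball_eq n (k := 3 / 20) (by norm_num)
  have hp0 : 0 < p := by linarith
  set c : ℝ≥0∞ := (ENNReal.ofReal (1 / 20) * K ^ 2) ^ p with hc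
  have hc0' : ENNReal.ofReal (1 / 20) * K ^ 2 ≠ 0 := by simp [hK0]
  have hct' : ENNReal.ofReal (1 / 20) * K ^ 2 ≠ ⊤ :=
    ENNReal.mul_ne_top ENNReal.ofReal_ne_top (by simp [hKt])
  have hc0 : c ≠ 0 := (ENNReal.rpow_pos (pos_iff_ne_zero.2 hc0') hct').ne'
  have hct : c ≠ ⊤ := ENNReal.rpow_ne_top_of_nonneg hp0.le hct'
  set c' : ℝ≥0∞ := (8 ^ ((n : ℝ) + 2)) ^ p * (K' ^ (p - 1) * K ^ (p - 1) * 2 ^ |b|) with hc'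
  have hc't : c' ≠ ⊤ := by
    refine ENNReal.mul_ne_top (ENNReal.rpow_ne_top_of_nonneg hp0.le
      (ENNReal.rpow_ne_top_of_nonneg (by positivity) (by norm_num)))
      (ENNReal.mul_ne_top (ENNReal.mul_ne_top ?_ ?_) ?_)
    · exact ENNReal.rpow_ne_top_of_nonneg (by linarith) hK't
    · exact ENNReal.rpow_ne_top_of_nonneg (by linarith) hKt
    · exact ENNReal.rpow_ne_top_of_nonneg (abs_nonneg _) (by norm_num)
  refine ⟨c⁻¹ * c', ENNReal.mul_ne_top (ENNReal.inv_ne_top.2 hc0) hc't, ?_⟩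
  intro Ω hΩ hfr f hf hfc x hx x' hx'
  set D := ENNReal.ofReal (bdryDist Ω x) with hD
  have hD0 : D ≠ 0 := ofReal_bdryDist_ne_zero hΩ hfr hx
  have hDt : D ≠ ⊤ := ENNReal.ofReal_ne_top
  have hx0 := coreRadius_pos hΩ hfr hx
  have h1 := volume_sq_mul_enorm_tentAverage_sub_le hx0
    (hfc.mono (closedBall_three_coreRadius_subset hΩ hfr hx)) hx'
  have h2 := coreOsc_rpow_le (b := b) hΩ hfr hp hs hf hx
  have h3 := ENNReal.rpow_le_rpow h1 hp0.le
  rw [show 3 * coreRadius Ω x = 3 / 20 * bdryDist Ω x by unfold coreRadius; ring,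
    hK' Ω hΩ hfr x hx] at h2
  rw [hK Ω hΩ hfr x hx] at h2 h3
  rw [← hD] at h2 h3
  set a := ‖tentAverage Ω f x' - tentAverage Ω f x‖ₑ
  set T := ENNReal.ofReal (dist x' x)
  set m := coreEnergy Ω s p b f x
  have e1 : ENNReal.ofReal (coreRadius Ω x) = ENNReal.ofReal (1 / 20) * D := by
    rw [hD, ← ENNReal.ofReal_mul (by norm_num), coreRadius]; congr 1; ring
  have e2 : (ENNReal.ofReal (coreRadius Ω x) * (K * D ^ (n : ℝ)) ^ 2 * a) ^ p =
      c * D ^ (p + 2 * n * p) * a ^ p := by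
    rw [e1, show ENNReal.ofReal (1 / 20) * D * (K * D ^ (n : ℝ)) ^ 2 * a =
      (ENNReal.ofReal (1 / 20) * K ^ 2) * (D * (D ^ (n : ℝ) * D ^ (n : ℝ))) * a by ring,
      ENNReal.mul_rpow_of_nonneg _ _ hp0.le, ENNReal.mul_rpow_of_nonneg _ _ hp0.le,
      ← ENNReal.rpow_add _ _ hD0 hDt]
    nth_rw 1 [← ENNReal.rpow_one D]
    rw [← ENNReal.rpow_add _ _ hD0 hDt, ← ENNReal.rpow_mul]
    congr 3; ring
  have e3 : (K' * D ^ (n : ℝ)) ^ (p - 1) * (K * D ^ (n : ℝ)) ^ (p - 1) *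
      (2 ^ |b| * D ^ (n + s * p - b)) * m =
      K' ^ (p - 1) * K ^ (p - 1) * 2 ^ |b| * D ^ (2 * n * p - n + s * p - b) * m := by
    rw [ENNReal.mul_rpow_of_nonneg _ _ (by linarith), ENNReal.mul_rpow_of_nonneg _ _ (by linarith),
      ← ENNReal.rpow_mul, show 2 * n * p - n + s * p - b =
        n * (p - 1) + n * (p - 1) + (n + s * p - b) by ring,
      ENNReal.rpow_add _ _ hD0 hDt, ENNReal.rpow_add _ _ hD0 hDt]
    ring
  rw [e3] at h2
  rw [e2, ENNReal.mul_rpow_of_nonneg _ _ hp0.le, ENNReal.mul_rpow_of_nonneg _ _ hp0.le] at h3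
  have hDp0 : c * D ^ (p + 2 * n * p) ≠ 0 := mul_ne_zero hc0 (by simp [hD0, hDt])
  have hDpt : c * D ^ (p + 2 * n * p) ≠ ⊤ := ENNReal.mul_ne_top hct (by simp [hD0, hDt])
  refine (ENNReal.mul_le_mul_iff_right hDp0 hDpt).1 (h3.trans ?_)
  calc _ ≤ (8 ^ ((n : ℝ) + 2)) ^ p * T ^ p *
        (K' ^ (p - 1) * K ^ (p - 1) * 2 ^ |b| * D ^ (2 * n * p - n + s * p - b) * m) := by gcongr
    _ = c' * (T ^ p * (D ^ (2 * n * p - n + s * p - b) * m)) := by rw [hc']; ring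
    _ = (c * c⁻¹) * c' * (T ^ p * ((D ^ (p + 2 * n * p) * D ^ (s * p - p - n - b)) * m)) := by
      rw [ENNReal.mul_inv_cancel hc0 hct, one_mul, ← ENNReal.rpow_add _ _ hD0 hDt]
      congr 5; ring
    _ = _ := by ring

end Kernel

/-! ### The local error f - A -/

section Local

variable {p q s : ℝ}

theorem measurable_tentAverage {n : ℕ} (Ω : Set (EuclideanSpace ℝ (Fin n)))
    {f : EuclideanSpace ℝ (Fin n) → ℝ} (hf : Measurable f) : Measurable (tentAverage Ω f) := by
  have h := (continuous_tent_uncurry Ω).measurable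
  exact ((h.mul (hf.comp measurable_snd)).stronglyMeasurable.integral_prod_right'
    (ν := volume)).measurable.div (h.stronglyMeasurable.integral_prod_right' (ν := volume)).measurable

theorem exists_lintegral_core_rpow_sub_tentAverage_le {n : ℕ} (hn : 0 < n) (hp : 1 ≤ p)
    (hpq : p ≤ q) (hsq : n - n * p / q ≤ s * p) (b : ℝ) :
    ∃ C : ℝ≥0∞, C ≠ ⊤ ∧ ∀ (Ω : Set (EuclideanSpace ℝ (Fin n))) (_ : IsOpen Ω)
      (_ : (frontier Ω).Nonempty) (f : EuclideanSpace ℝ (Fin n) → ℝ) (_ : Measurable f)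
      (_ : ContinuousOn f Ω), ∀ x ∈ Ω,
      ∫⁻ y in Metric.ball x (coreRadius Ω x), ‖f y - tentAverage Ω f x‖ₑ ^ q ≤
        C * (ENNReal.ofReal (bdryDist Ω x) ^ (s * p - n + n * p / q - b) *
          coreEnergy Ω s p b f x) ^ (q / p) := by
  have hp0 : 0 < p := by linarith
  have hq0 : 0 < q := by linarith
  obtain ⟨C, hC, H⟩ := exists_lintegral_ball_rpow_le hn hp hpq (C₀ := 2 ^ ((n : ℝ) + 1))
    (ENNReal.rpow_ne_top_of_nonneg (by positivity) (by norm_num))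
  have h2 : (2 : ℝ≥0∞) ^ |b| ≠ ⊤ := ENNReal.rpow_ne_top_of_nonneg (abs_nonneg _) (by norm_num)
  refine ⟨C * (2 ^ |b|) ^ (q / p), ENNReal.mul_ne_top hC
    (ENNReal.rpow_ne_top_of_nonneg (by positivity) h2), ?_⟩
  intro Ω hΩ hfr f hf hfc x hx
  have hx0 := coreRadius_pos hΩ hfr hx
  set D := ENNReal.ofReal (bdryDist Ω x) with hD
  have hD0 : D ≠ 0 := ofReal_bdryDist_ne_zero hΩ hfr hx
  have hDt : D ≠ ⊤ := ENNReal.ofReal_ne_top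
  have hfB : ContinuousOn f (Metric.closedBall x (coreRadius Ω x)) :=
    hfc.mono ((Metric.closedBall_subset_closedBall (by linarith)).trans
      (closedBall_three_coreRadius_subset hΩ hfr hx))
  set A := tentAverage Ω f x with hA
  refine (H x (coreRadius Ω x) hx0 f A (fun y z => 2 ^ |b| *
    D ^ (n + s * p - (2 * n - n * p / q) - b) * fracKernel Ω s p b f y z) hf ?_ ?_ ?_).trans ?_
  · intro y hy z hz
    -- The condition e ≤ n + sp for e = 2n - np/q is `hsq`, the Sobolev restriction on q.
    exact enorm_sub_rpow_le_fracKernel hΩ hfr hp0 hx (by linarith)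
      (ball_coreRadius_subset x hy) (ball_coreRadius_subset x hz)
  · intro y _
    exact volume_ball_mul_enorm_sub_tentAverage_le hx0 hfB y
  -- The finiteness needed for absorption: f is bounded on the compact closed ball.
  · obtain ⟨M, hM⟩ := (isCompact_closedBall x (coreRadius Ω x)).exists_bound_of_continuousOn
      (hfB.sub (continuousOn_const (c := A)))
    refine ne_top_of_le_ne_top (b := ENNReal.ofReal M ^ q *
      volume (Metric.ball x (coreRadius Ω x))) (ENNReal.mul_ne_top
      (ENNReal.rpow_ne_top_of_nonneg hq0.le ENNReal.ofReal_ne_top) measure_ball_lt_top.ne) ?_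
    rw [← setLIntegral_const]
    refine setLIntegral_mono' measurableSet_ball fun y hy => ?_
    refine ENNReal.rpow_le_rpow ?_ hq0.le
    rw [← ofReal_norm]
    exact ENNReal.ofReal_le_ofReal (hM y (Metric.ball_subset_closedBall hy))
  · have hct : (2 : ℝ≥0∞) ^ |b| * D ^ (n + s * p - (2 * n - n * p / q) - b) ≠ ⊤ :=
      ENNReal.mul_ne_top h2 (by simp [hD0, hDt])
    rw [mul_assoc C, ← ENNReal.mul_rpow_of_nonneg _ _ (by positivity : 0 ≤ q / p), ← mul_assoc]
    refine mul_le_mul_right (ENNReal.rpow_le_rpow ?_ (by positivity)) _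
    rw [show s * p - n + n * p / q - b = n + s * p - (2 * n - n * p / q) - b by ring, coreEnergy,
      ← lintegral_const_mul' _ _ hct]
    refine le_trans ?_ (lintegral_mono_set (ball_coreRadius_subset x))
    refine setLIntegral_mono' measurableSet_ball fun w hw => ?_
    rw [lintegral_const_mul' _ _ hct]
    gcongr
    exact setLIntegral_fracKernel_le_fracEnergy hΩ hfr hx (ball_coreRadius_subset x hw)

/-- Replacing A(x) by A(y) removes the dependence on the centre, so that the estimates can be
integrated over x. The change is controlled by the Lipschitz bound with |x - y| ≤ d(x), and the
volume d(x)^n restores the same power of d(x). -/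
theorem exists_lintegral_core_rpow_sub_tentAverage_self_le {n : ℕ} (hn : 0 < n) (hp : 1 ≤ p)
    (hpq : p ≤ q) (hs : 0 ≤ s) (hsq : n - n * p / q ≤ s * p) (b : ℝ) :
    ∃ C : ℝ≥0∞, C ≠ ⊤ ∧ ∀ (Ω : Set (EuclideanSpace ℝ (Fin n))) (_ : IsOpen Ω)
      (_ : (frontier Ω).Nonempty) (f : EuclideanSpace ℝ (Fin n) → ℝ) (_ : Measurable f)
      (_ : ContinuousOn f Ω), ∀ x ∈ Ω,
      ∫⁻ y in Metric.ball x (coreRadius Ω x), ‖f y - tentAverage Ω f y‖ₑ ^ q ≤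
        C * (ENNReal.ofReal (bdryDist Ω x) ^ (s * p - n + n * p / q - b) *
          coreEnergy Ω s p b f x) ^ (q / p) := by
  have hp0 : 0 < p := by linarith
  have hq0 : 0 < q := by linarith
  have hqp : 0 ≤ q / p := by positivity
  obtain ⟨C₁, hC₁, H₁⟩ := exists_lintegral_core_rpow_sub_tentAverage_le hn hp hpq hsq b
  obtain ⟨C₂, hC₂, H₂⟩ := exists_enorm_tentAverage_sub_rpow_le n hp hs b
  obtain ⟨K, hK0, hKt, hK⟩ := exists_volume_ball_coreRadius_eq n
  refine ⟨2 ^ q * (C₁ + C₂ ^ (q / p) * K), ENNReal.mul_ne_top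
    (ENNReal.rpow_ne_top_of_nonneg hq0.le (by norm_num)) (ENNReal.add_ne_top.2 ⟨hC₁,
      ENNReal.mul_ne_top (ENNReal.rpow_ne_top_of_nonneg hqp hC₂) hKt⟩), ?_⟩
  intro Ω hΩ hfr f hf hfc x hx
  have h1 := H₁ Ω hΩ hfr f hf hfc x hx
  set D := ENNReal.ofReal (bdryDist Ω x) with hD
  have hD0 : D ≠ 0 := ofReal_bdryDist_ne_zero hΩ hfr hx
  have hDt : D ≠ ⊤ := ENNReal.ofReal_ne_top
  set A := tentAverage Ω f x with hA
  set m := coreEnergy Ω s p b f x with hm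
  have h2 : ∀ y ∈ Metric.ball x (coreRadius Ω x), ‖A - tentAverage Ω f y‖ₑ ^ q ≤
      (C₂ * (D ^ (s * p - n - b) * m)) ^ (q / p) := by
    intro y hy
    rw [show q = p * (q / p) by field_simp, ENNReal.rpow_mul, mul_div_cancel₀ _ hp0.ne']
    refine ENNReal.rpow_le_rpow ?_ hqp
    rw [enorm_sub_rev]
    have hy' := (Metric.mem_ball.1 hy).le
    refine (H₂ Ω hΩ hfr f hf hfc x hx y hy').trans ?_
    refine mul_le_mul_right ?_ _
    rw [← mul_assoc, show s * p - n - b = p + (s * p - p - n - b) by ring,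
      ENNReal.rpow_add _ _ hD0 hDt]
    refine mul_le_mul_left (mul_le_mul_left (ENNReal.rpow_le_rpow
      (ENNReal.ofReal_le_ofReal (hy'.trans ?_)) hp0.le) _) _
    unfold coreRadius
    linarith [bdryDist_pos hΩ hfr hx]
  have h3 : ∫⁻ y in Metric.ball x (coreRadius Ω x), ‖A - tentAverage Ω f y‖ₑ ^ q ≤
      C₂ ^ (q / p) * K * (D ^ (s * p - n + n * p / q - b) * m) ^ (q / p) := by
    refine (setLIntegral_mono' measurableSet_ball h2).trans (le_of_eq ?_)
    rw [setLIntegral_const, hK Ω hΩ hfr x hx, ENNReal.mul_rpow_of_nonneg _ _ hqp,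
      ENNReal.mul_rpow_of_nonneg _ _ hqp, ENNReal.mul_rpow_of_nonneg _ _ hqp, ← ENNReal.rpow_mul,
      ← ENNReal.rpow_mul, ← hD, show (s * p - n + n * p / q - b) * (q / p) =
        (s * p - n - b) * (q / p) + n by field_simp; ring, ENNReal.rpow_add _ _ hD0 hDt]
    ring
  have hmeas : Measurable fun y => ‖f y - A‖ₑ ^ q := (hf.sub_const A).enorm.pow_const q
  calc _ ≤ ∫⁻ y in Metric.ball x (coreRadius Ω x),
        2 ^ q * (‖f y - A‖ₑ ^ q + ‖A - tentAverage Ω f y‖ₑ ^ q) := by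
        refine lintegral_mono fun y => ?_
        refine le_trans (ENNReal.rpow_le_rpow ?_ hq0.le)
          (ENNReal.add_rpow_le_two_rpow_mul hq0.le _ _)
        rw [← sub_add_sub_cancel (f y) A (tentAverage Ω f y)]
        exact enorm_add_le _ _
    _ = 2 ^ q * ((∫⁻ y in Metric.ball x (coreRadius Ω x), ‖f y - A‖ₑ ^ q) +
        ∫⁻ y in Metric.ball x (coreRadius Ω x), ‖A - tentAverage Ω f y‖ₑ ^ q) := by
        rw [lintegral_const_mul' _ _ (ENNReal.rpow_ne_top_of_nonneg hq0.le (by norm_num)),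
          lintegral_add_left hmeas]
    _ ≤ _ := by
      rw [mul_assoc, add_mul]
      gcongr

/-- Bounded overlap in continuous form: the centres x whose tripled ball contains w lie in B(w,
d(w)) and have d(x) comparable to d(w), so d(x)^(-n) integrates over them to a constant. -/
theorem exists_lintegral_coreEnergy_le (n : ℕ) :
    ∃ C : ℝ≥0∞, C ≠ ⊤ ∧ ∀ (Ω : Set (EuclideanSpace ℝ (Fin n))) (_ : IsOpen Ω)
      (_ : (frontier Ω).Nonempty) (f : EuclideanSpace ℝ (Fin n) → ℝ) (_ : Measurable f)
      (s p b : ℝ),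
      ∫⁻ x in Ω, ENNReal.ofReal (bdryDist Ω x) ^ (-(n : ℝ)) * coreEnergy Ω s p b f x ≤
        C * ∫⁻ w in Ω, fracEnergy Ω s p b f w := by
  obtain ⟨K, hK0, hKt, hK⟩ := exists_volume_ball_eq n (k := 1) (by norm_num)
  have h2t : (2 : ℝ≥0∞) ^ |(-(n : ℝ))| ≠ ⊤ :=
    ENNReal.rpow_ne_top_of_nonneg (abs_nonneg _) (by norm_num)
  refine ⟨2 ^ |(-(n : ℝ))| * K, ENNReal.mul_ne_top h2t hKt, ?_⟩
  intro Ω hΩ hfr f hf s p b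
  set D : EuclideanSpace ℝ (Fin n) → ℝ≥0∞ := fun x => ENNReal.ofReal (bdryDist Ω x) with hD
  have hDm : Measurable D := (continuous_bdryDist Ω).measurable.ennreal_ofReal
  set S : Set (EuclideanSpace ℝ (Fin n) × EuclideanSpace ℝ (Fin n)) :=
    {a | dist a.2 a.1 < 3 * coreRadius Ω a.1} with hS
  have hSm : MeasurableSet S := measurableSet_lt (measurable_snd.dist measurable_fst)
    (((continuous_coreRadius Ω).measurable.comp measurable_fst).const_mul _)
  have hH := measurable_fracEnergy (s := s) (p := p) (b := b) hΩ hf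
  set F : EuclideanSpace ℝ (Fin n) → EuclideanSpace ℝ (Fin n) → ℝ≥0∞ :=
    fun x w => S.indicator (fun a => D a.1 ^ (-(n : ℝ)) * fracEnergy Ω s p b f a.2) (x, w) with hF
  have hFm : Measurable (Function.uncurry F) :=
    (((hDm.comp measurable_fst).pow_const _).mul (hH.comp measurable_snd)).indicator hSm
  have e1 : ∀ x ∈ Ω, D x ^ (-(n : ℝ)) * coreEnergy Ω s p b f x ≤ ∫⁻ w in Ω, F x w := by
    intro x hx
    have hD0 : D x ≠ 0 := ofReal_bdryDist_ne_zero hΩ hfr hx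
    have hDt : D x ≠ ⊤ := ENNReal.ofReal_ne_top
    rw [coreEnergy, ← lintegral_const_mul' _ _ (by simp [hD0, hDt])]
    refine le_trans (setLIntegral_mono' (g := F x) measurableSet_ball fun w hw => ?_)
      (lintegral_mono_set (ball_three_coreRadius_subset hΩ hfr hx))
    have : (x, w) ∈ S := Metric.mem_ball.1 hw
    simp [hF, this]
  have e2 : ∀ w ∈ Ω, ∫⁻ x in Ω, F x w ≤ 2 ^ |(-(n : ℝ))| * K * fracEnergy Ω s p b f w := by
    intro w hw
    have hD0 : D w ≠ 0 := ofReal_bdryDist_ne_zero hΩ hfr hw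
    have hDt : D w ≠ ⊤ := ENNReal.ofReal_ne_top
    have hle : ∀ x ∈ Ω, F x w ≤ (Metric.ball w (1 * bdryDist Ω w)).indicator
        (fun _ => 2 ^ |(-(n : ℝ))| * D w ^ (-(n : ℝ)) * fracEnergy Ω s p b f w) x := by
      intro x hx
      by_cases hxw : (x, w) ∈ S
      · have hwx : w ∈ Metric.ball x (3 * coreRadius Ω x) := hxw
        obtain ⟨h1, h2⟩ := bdryDist_bounds_of_mem_ball hwx
        have hd := bdryDist_pos hΩ hfr hx
        have h3 : x ∈ Metric.ball w (1 * bdryDist Ω w) := by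
          have := Metric.mem_ball'.1 hwx
          unfold coreRadius at this
          rw [Metric.mem_ball]
          linarith
        rw [indicator_of_mem h3, hF]
        simp only [hxw, indicator_of_mem]
        gcongr
        exact ENNReal.rpow_le_mul_rpow_of_le_of_le (by norm_num) (by norm_num)
          (ofReal_bdryDist_le_two_mul (by linarith)) (ofReal_bdryDist_le_two_mul (by linarith)) _
      · simp [hF, hxw]
    refine (setLIntegral_mono' hΩ.measurableSet hle).trans ?_
    refine (setLIntegral_le_lintegral _ _).trans (le_of_eq ?_)
    rw [lintegral_indicator measurableSet_ball, setLIntegral_const, hK Ω hΩ hfr w hw w]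
    calc _ = 2 ^ |(-(n : ℝ))| * K * (D w ^ (-(n : ℝ)) * D w ^ (n : ℝ)) *
          fracEnergy Ω s p b f w := by ring
      _ = _ := by rw [← ENNReal.rpow_add _ _ hD0 hDt]; simp
  calc _ ≤ ∫⁻ x in Ω, ∫⁻ w in Ω, F x w := setLIntegral_mono' hΩ.measurableSet e1
    _ = ∫⁻ w in Ω, ∫⁻ x in Ω, F x w := lintegral_lintegral_swap hFm.aemeasurable
    _ ≤ ∫⁻ w in Ω, 2 ^ |(-(n : ℝ))| * K * fracEnergy Ω s p b f w :=
      setLIntegral_mono' hΩ.measurableSet e2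
    _ = _ := lintegral_const_mul' _ _ (ENNReal.mul_ne_top h2t hKt)

/-- The covering counterpart: y belongs to the core ball of every x with |x - y| < d(y)/40, a set of
measure comparable to d(y)^n. -/
theorem exists_lintegral_le_lintegral_core (n : ℕ) (a : ℝ) :
    ∃ C : ℝ≥0∞, C ≠ ⊤ ∧ ∀ (Ω : Set (EuclideanSpace ℝ (Fin n))) (_ : IsOpen Ω)
      (_ : (frontier Ω).Nonempty) (F : EuclideanSpace ℝ (Fin n) → ℝ≥0∞) (_ : Measurable F),
      ∫⁻ y in Ω, F y * ENNReal.ofReal (bdryDist Ω y) ^ a ≤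
        C * ∫⁻ x in Ω, ENNReal.ofReal (bdryDist Ω x) ^ (a - n) *
          ∫⁻ y in Metric.ball x (coreRadius Ω x), F y := by
  obtain ⟨K, hK0, hKt, hK⟩ := exists_volume_ball_eq n (k := 1 / 40) (by norm_num)
  have h2t : (2 : ℝ≥0∞) ^ |a - n| ≠ ⊤ := ENNReal.rpow_ne_top_of_nonneg (abs_nonneg _) (by norm_num)
  have hKit : K⁻¹ ≠ ⊤ := ENNReal.inv_ne_top.2 hK0
  refine ⟨K⁻¹ * 2 ^ |a - n|, ENNReal.mul_ne_top hKit h2t, ?_⟩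
  intro Ω hΩ hfr F hF
  set D : EuclideanSpace ℝ (Fin n) → ℝ≥0∞ := fun x => ENNReal.ofReal (bdryDist Ω x) with hD
  have hDm : Measurable D := (continuous_bdryDist Ω).measurable.ennreal_ofReal
  set S : Set (EuclideanSpace ℝ (Fin n) × EuclideanSpace ℝ (Fin n)) :=
    {v | dist v.2 v.1 < coreRadius Ω v.1} with hS
  have hSm : MeasurableSet S := measurableSet_lt (measurable_snd.dist measurable_fst)
    ((continuous_coreRadius Ω).measurable.comp measurable_fst)
  set G : EuclideanSpace ℝ (Fin n) → EuclideanSpace ℝ (Fin n) → ℝ≥0∞ :=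
    fun y x => S.indicator (fun v => D v.1 ^ (a - n) * F v.2) (x, y) with hG
  have hGm : Measurable (Function.uncurry G) :=
    ((((hDm.comp measurable_fst).pow_const _).mul (hF.comp measurable_snd)).indicator hSm).comp
      measurable_swap
  have e1 : ∀ y ∈ Ω, F y * D y ^ a ≤ K⁻¹ * 2 ^ |a - n| * ∫⁻ x in Ω, G y x := by
    intro y hy
    have hd := bdryDist_pos hΩ hfr hy
    have hD0 : D y ≠ 0 := ofReal_bdryDist_ne_zero hΩ hfr hy
    have hDt : D y ≠ ⊤ := ENNReal.ofReal_ne_top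
    have hsub : Metric.ball y (1 / 40 * bdryDist Ω y) ⊆ Ω :=
      (Metric.ball_subset_ball (by linarith)).trans (ball_bdryDist_subset hΩ hy)
    have hle : ∀ x ∈ Metric.ball y (1 / 40 * bdryDist Ω y),
        D y ^ (a - n) * F y ≤ 2 ^ |a - n| * G y x := by
      intro x hx
      have hxy := Metric.mem_ball.1 hx
      have h1 := bdryDist_le_add_dist Ω x y
      have h2 := bdryDist_le_add_dist Ω y x
      rw [dist_comm y x] at h2
      have hxS : (x, y) ∈ S := by
        change dist y x < coreRadius Ω x
        rw [dist_comm, coreRadius]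
        linarith
      simp only [hG, hxS, indicator_of_mem]
      rw [← mul_assoc]
      gcongr
      exact ENNReal.rpow_le_mul_rpow_of_le_of_le (by norm_num) (by norm_num)
        (ofReal_bdryDist_le_two_mul (by linarith)) (ofReal_bdryDist_le_two_mul (by linarith)) _
    rw [mul_assoc]
    calc F y * D y ^ a = K⁻¹ * K * (D y ^ (a - n) * D y ^ (n : ℝ)) * F y := by
          rw [ENNReal.inv_mul_cancel hK0 hKt, ← ENNReal.rpow_add _ _ hD0 hDt, sub_add_cancel]
          ring
      _ = K⁻¹ * ∫⁻ x in Metric.ball y (1 / 40 * bdryDist Ω y), D y ^ (a - n) * F y := by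
          rw [setLIntegral_const, hK Ω hΩ hfr y hy y]; ring
      _ ≤ K⁻¹ * ∫⁻ x in Metric.ball y (1 / 40 * bdryDist Ω y), 2 ^ |a - n| * G y x := by
          refine mul_le_mul_right ?_ _
          exact setLIntegral_mono' measurableSet_ball hle
      _ = K⁻¹ * (2 ^ |a - n| * ∫⁻ x in Metric.ball y (1 / 40 * bdryDist Ω y), G y x) := by
          rw [lintegral_const_mul' _ _ h2t]
      _ ≤ _ := by
        gcongr
  have e2 : ∀ x ∈ Ω, ∫⁻ y in Ω, G y x ≤
      D x ^ (a - n) * ∫⁻ y in Metric.ball x (coreRadius Ω x), F y := by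
    intro x hx
    have hD0 : D x ≠ 0 := ofReal_bdryDist_ne_zero hΩ hfr hx
    have hDt : D x ≠ ⊤ := ENNReal.ofReal_ne_top
    refine (setLIntegral_le_lintegral _ _).trans ?_
    rw [← lintegral_const_mul' _ _ (by simp [hD0, hDt]), ← lintegral_indicator measurableSet_ball]
    refine lintegral_mono fun y => ?_
    by_cases hy : (x, y) ∈ S
    · have : y ∈ Metric.ball x (coreRadius Ω x) := hy
      simp [hG, hy, this]
    · simp [hG, hy]
  calc _ ≤ ∫⁻ y in Ω, K⁻¹ * 2 ^ |a - n| * ∫⁻ x in Ω, G y x :=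
        setLIntegral_mono' hΩ.measurableSet e1
    _ = K⁻¹ * 2 ^ |a - n| * ∫⁻ y in Ω, ∫⁻ x in Ω, G y x :=
        lintegral_const_mul' _ _ (ENNReal.mul_ne_top hKit h2t)
    _ = K⁻¹ * 2 ^ |a - n| * ∫⁻ x in Ω, ∫⁻ y in Ω, G y x := by
        rw [lintegral_lintegral_swap hGm.aemeasurable]
    _ ≤ _ := by
      refine mul_le_mul_right ?_ _
      exact setLIntegral_mono' hΩ.measurableSet e2

/-- As q ≥ p, one factor of the local energy is kept for the overlap bound and the power q/p - 1 is
estimated by the total energy. The surplus power e of d is nonnegative by `hab`, hence bounded on Ω.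
-/
theorem exists_lintegral_rpow_sub_tentAverage_le {n : ℕ} (hn : 0 < n) (hp : 1 ≤ p)
    (hpq : p ≤ q) (hs : 0 ≤ s) (hsq : n - n * p / q ≤ s * p) {a b : ℝ}
    (hab : b ≤ (n + a) * p / q + s * p - n) {Ω : Set (EuclideanSpace ℝ (Fin n))}
    (hΩ : IsOpen Ω) (hfr : (frontier Ω).Nonempty) (hbd : Bornology.IsBounded Ω) :
    ∃ C : ℝ≥0∞, C ≠ ⊤ ∧ ∀ (f : EuclideanSpace ℝ (Fin n) → ℝ) (_ : Measurable f)
      (_ : ContinuousOn f Ω),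
      ∫⁻ y in Ω, ‖f y - tentAverage Ω f y‖ₑ ^ q * ENNReal.ofReal (bdryDist Ω y) ^ a ≤
        C * (∫⁻ w in Ω, fracEnergy Ω s p b f w) ^ (q / p) := by
  have hp0 : 0 < p := by linarith
  have hq0 : 0 < q := by linarith
  have hqp : 0 ≤ q / p := by positivity
  have hqp1 : 0 ≤ q / p - 1 := by rw [sub_nonneg, one_le_div hp0]; exact hpq
  obtain ⟨C₁, hC₁, H₁⟩ := exists_lintegral_core_rpow_sub_tentAverage_self_le hn hp hpq hs hsq b
  obtain ⟨C₂, hC₂, H₂⟩ := exists_lintegral_coreEnergy_le n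
  obtain ⟨C₃, hC₃, H₃⟩ := exists_lintegral_le_lintegral_core n a
  obtain ⟨M, hM1, hM⟩ := exists_bdryDist_le hbd hfr
  set e := a + n + (s * p - n - b) * (q / p) with he
  have he0 : 0 ≤ e := by
    have h1 : -((n + a) * p / q) ≤ s * p - n - b := by linarith
    have h2 : -((n + a) * p / q) * (q / p) ≤ (s * p - n - b) * (q / p) := by gcongr
    have h3 : -((n + a) * p / q) * (q / p) = -(n + a) := by field_simp
    linarith
  set M' := ENNReal.ofReal M ^ e with hM'
  have hM't : M' ≠ ⊤ := ENNReal.rpow_ne_top_of_nonneg he0 ENNReal.ofReal_ne_top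
  refine ⟨C₃ * (C₁ * M' * C₂), ENNReal.mul_ne_top hC₃ (ENNReal.mul_ne_top
    (ENNReal.mul_ne_top hC₁ hM't) hC₂), ?_⟩
  intro f hf hfc
  set m := ∫⁻ w in Ω, fracEnergy Ω s p b f w with hm
  have hFm : Measurable fun y => ‖f y - tentAverage Ω f y‖ₑ ^ q :=
    (hf.sub (measurable_tentAverage Ω hf)).enorm.pow_const q
  refine (H₃ Ω hΩ hfr _ hFm).trans ?_
  rw [mul_assoc C₃]
  refine mul_le_mul_right ?_ _
  have key : ∀ x ∈ Ω, ENNReal.ofReal (bdryDist Ω x) ^ (a - n) *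
      ∫⁻ y in Metric.ball x (coreRadius Ω x), ‖f y - tentAverage Ω f y‖ₑ ^ q ≤
      C₁ * M' * m ^ (q / p - 1) *
        (ENNReal.ofReal (bdryDist Ω x) ^ (-(n : ℝ)) * coreEnergy Ω s p b f x) := by
    intro x hx
    have h1 := H₁ Ω hΩ hfr f hf hfc x hx
    have hcm : coreEnergy Ω s p b f x ≤ m := coreEnergy_le hΩ hfr hx
    have hDM : ENNReal.ofReal (bdryDist Ω x) ≤ ENNReal.ofReal M :=
      ENNReal.ofReal_le_ofReal (hM x hx)
    have hD0 := ofReal_bdryDist_ne_zero hΩ hfr hx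
    set D := ENNReal.ofReal (bdryDist Ω x) with hD
    have hDt : D ≠ ⊤ := ENNReal.ofReal_ne_top
    set c := coreEnergy Ω s p b f x with hc
    have hcc : c ^ (q / p) ≤ m ^ (q / p - 1) * c := by
      calc c ^ (q / p) = c ^ (q / p - 1 + 1) := by rw [sub_add_cancel]
        _ = c ^ (q / p - 1) * c := by
          rw [ENNReal.rpow_add_of_nonneg _ _ hqp1 zero_le_one, ENNReal.rpow_one]
        _ ≤ _ := by gcongr
    calc _ ≤ D ^ (a - n) * (C₁ * (D ^ (s * p - n + n * p / q - b) * c) ^ (q / p)) := by gcongr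
      _ = C₁ * D ^ e * D ^ (-(n : ℝ)) * c ^ (q / p) := by
        rw [ENNReal.mul_rpow_of_nonneg _ _ hqp, ← ENNReal.rpow_mul, mul_assoc C₁,
          ← ENNReal.rpow_add _ _ hD0 hDt,
          show e + -(n : ℝ) = (a - n) + (s * p - n + n * p / q - b) * (q / p) by
            rw [he]; field_simp; ring, ENNReal.rpow_add _ _ hD0 hDt]
        ring
      _ ≤ C₁ * M' * D ^ (-(n : ℝ)) * (m ^ (q / p - 1) * c) := by
        rw [hM']; gcongr
      _ = _ := by ring
  refine (setLIntegral_mono' hΩ.measurableSet key).trans ?_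
  have hDm : Measurable fun x => ENNReal.ofReal (bdryDist Ω x) ^ (-(n : ℝ)) :=
    (continuous_bdryDist Ω).measurable.ennreal_ofReal.pow_const _
  rw [lintegral_const_mul _ (f := fun x => ENNReal.ofReal (bdryDist Ω x) ^ (-(n : ℝ)) *
    coreEnergy Ω s p b f x) (hDm.mul (measurable_coreEnergy hΩ hf))]
  calc _ ≤ C₁ * M' * m ^ (q / p - 1) * (C₂ * m) := mul_le_mul_right (H₂ Ω hΩ hfr f hf s p b) _
    _ = C₁ * M' * C₂ * (m ^ (q / p - 1) * m) := by ring
    _ = _ := by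
      congr 1
      nth_rw 2 [← ENNReal.rpow_one m]
      rw [← ENNReal.rpow_add_of_nonneg _ _ hqp1 zero_le_one, sub_add_cancel]

end Local

/-! ### The fundamental theorem of calculus along a Lipschitz curve -/

theorem norm_deriv_comp_le_of_local {E : Type*} [NormedAddCommGroup E] [NormedSpace ℝ E]
    {g : ℝ → E} {h : ℝ → ℝ} {t L : ℝ} (hg : DifferentiableAt ℝ g t)
    (hL : 0 ≤ L) (hloc : ∀ᶠ t' in nhds t, |h t' - h t| ≤ L * ‖g t' - g t‖) :
    ‖deriv h t‖ ≤ L * ‖deriv g t‖ := by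
  by_cases hh : DifferentiableAt ℝ h t
  · have h1 := (hasDerivAt_iff_tendsto_slope.1 hh.hasDerivAt).norm
    have h2 := (hasDerivAt_iff_tendsto_slope.1 hg.hasDerivAt).norm.const_mul L
    refine le_of_tendsto_of_tendsto h1 h2 ?_
    filter_upwards [hloc.filter_mono nhdsWithin_le_nhds] with t' ht'
    rw [slope_def_module, slope_def_module, norm_smul, norm_smul, mul_left_comm]
    exact mul_le_mul_of_nonneg_left ht' (norm_nonneg _)
  -- The default value 0 of `deriv` makes this case trivial.
  · rw [deriv_zero_of_not_differentiableAt hh, norm_zero]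
    positivity

/-- `A` need not be differentiable, so there is no chain rule; but `A` composed with the curve is
Lipschitz, hence absolutely continuous, and difference quotients bound its derivative wherever the
curve is differentiable. The uniform bound `B` serves only for absolute continuity and leaves no
trace in the estimate. -/
theorem enorm_sub_le_lintegral_of_locally_lipschitz {E : Type*} [NormedAddCommGroup E]
    [NormedSpace ℝ E] [FiniteDimensional ℝ E] {g : ℝ → E} {K : ℝ≥0}
    (hg : LipschitzOnWith K g (Icc 0 1)) {A : E → ℝ} {ρ : ℝ} (hρ : 0 < ρ) {Λ : ℝ → ℝ≥0∞}
    {B : ℝ≥0} (hB : ∀ t ∈ Icc (0 : ℝ) 1, Λ t ≤ B)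
    (hA : ∀ t ∈ Icc (0 : ℝ) 1, ∀ x', dist x' (g t) ≤ ρ →
      ‖A x' - A (g t)‖ₑ ≤ Λ t * ENNReal.ofReal (dist x' (g t))) :
    ‖A (g 1) - A (g 0)‖ₑ ≤ ∫⁻ t in Icc (0 : ℝ) 1, Λ t * ‖deriv g t‖ₑ := by
  set h : ℝ → ℝ := fun t => A (g t) with hh
  have hreal : ∀ t ∈ Icc (0 : ℝ) 1, ∀ t', dist (g t') (g t) ≤ ρ →
      |h t' - h t| ≤ (Λ t).toReal * ‖g t' - g t‖ := by
    intro t ht t' htt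
    have hΛ : Λ t ≠ ⊤ := ne_top_of_le_ne_top ENNReal.coe_ne_top (hB t ht)
    have h1 := ENNReal.toReal_mono (ENNReal.mul_ne_top hΛ ENNReal.ofReal_ne_top)
      (hA t ht (g t') htt)
    rwa [toReal_enorm, ENNReal.toReal_mul, ENNReal.toReal_ofReal dist_nonneg, dist_eq_norm,
      Real.norm_eq_abs] at h1
  have hloc : LocallyLipschitzOn (Icc (0 : ℝ) 1) h := by
    intro t ht
    -- Two parameters in this ball have images within ρ of each other; K + 1 avoids dividing by
    -- zero.
    have hη : 0 < ρ / (2 * (K + 1)) := by positivity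
    refine ⟨B * K, Icc 0 1 ∩ Metric.ball t (ρ / (2 * (K + 1))),
      Filter.inter_mem self_mem_nhdsWithin (mem_nhdsWithin_of_mem_nhds (Metric.ball_mem_nhds _ hη)), ?_⟩
    refine LipschitzOnWith.of_dist_le_mul fun u hu v hv => ?_
    have huv : dist u v ≤ ρ / (K + 1) := by
      have h1 := Metric.mem_ball.1 hu.2
      have h2 := Metric.mem_ball'.1 hv.2
      have h3 : ρ / (2 * (K + 1)) + ρ / (2 * (K + 1)) = ρ / (K + 1) := by field_simp; ring
      linarith [dist_triangle u t v]
    have hguv : dist (g u) (g v) ≤ K * dist u v := hg.dist_le_mul u hu.1 v hv.1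
    have hle : dist (g u) (g v) ≤ ρ := by
      refine hguv.trans ?_
      calc (K : ℝ) * dist u v ≤ (K + 1) * (ρ / (K + 1)) := by gcongr; linarith
        _ = ρ := by field_simp
    have h1 := hreal v hv.1 u hle
    have h2 : (Λ v).toReal ≤ B := by
      have := ENNReal.toReal_mono ENNReal.coe_ne_top (hB v hv.1)
      simpa using this
    rw [Real.dist_eq, NNReal.coe_mul, mul_assoc]
    refine h1.trans ?_
    rw [← dist_eq_norm]
    gcongr
  obtain ⟨K', hK'⟩ := hloc.exists_lipschitzOnWith_of_compact isCompact_Icc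
  have hac : AbsolutelyContinuousOnInterval h 0 1 := by
    refine LipschitzOnWith.absolutelyContinuousOnInterval (K := K') ?_
    rwa [uIcc_of_le zero_le_one]
  have hftc := hac.integral_deriv_eq_sub
  change ‖h 1 - h 0‖ₑ ≤ _
  rw [← hftc, intervalIntegral.integral_of_le zero_le_one]
  refine (enorm_integral_le_lintegral_enorm _).trans ?_
  rw [← restrict_Ioo_eq_restrict_Ioc]
  refine le_trans ?_ (lintegral_mono_set Ioo_subset_Icc_self)
  refine lintegral_mono_ae ?_
  have hae := (ae_restrict_iff' measurableSet_Ioo).2 ((hg.mono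
    Ioo_subset_Icc_self).ae_differentiableWithinAt_of_mem (μ := volume))
  filter_upwards [hae, ae_restrict_mem measurableSet_Ioo] with t htd ht
  have htI : t ∈ Icc (0 : ℝ) 1 := Ioo_subset_Icc_self ht
  have hgd : DifferentiableAt ℝ g t := htd.differentiableAt (Ioo_mem_nhds ht.1 ht.2)
  have hΛ : Λ t ≠ ⊤ := ne_top_of_le_ne_top ENNReal.coe_ne_top (hB t htI)
  have key : ‖deriv h t‖ ≤ (Λ t).toReal * ‖deriv g t‖ := by
    refine norm_deriv_comp_le_of_local hgd ENNReal.toReal_nonneg ?_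
    filter_upwards [hgd.continuousAt (Metric.ball_mem_nhds _ hρ)] with t' ht'
    exact hreal t htI t' (Metric.mem_ball.1 ht').le
  rw [← ofReal_norm, ← ofReal_norm, ← ENNReal.ofReal_toReal hΛ,
    ← ENNReal.ofReal_mul ENNReal.toReal_nonneg]
  exact ENNReal.ofReal_le_ofReal (by simpa using key)

theorem ENNReal.rpow_le_rpow_of_le_of_nonpos {x y : ℝ≥0∞} {μ : ℝ} (hμ : μ ≤ 0) (h : x ≤ y) :
    y ^ μ ≤ x ^ μ := by
  rw [← neg_neg μ, ENNReal.rpow_neg y, ENNReal.rpow_neg x]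
  exact ENNReal.inv_le_inv.2 (ENNReal.rpow_le_rpow h (by linarith))

/-! ### Transport along the John curves -/

section Chain

variable {n : ℕ} {Ω : Set (EuclideanSpace ℝ (Fin n))} {x₀ : EuclideanSpace ℝ (Fin n)}
  {γ : EuclideanSpace ℝ (Fin n) → ℝ → EuclideanSpace ℝ (Fin n)} {β lam C₀ : ℝ} {K : ℝ≥0}

/-- The shadow estimate. The twisted cone condition gives t ≤ C d(w)^(1/β), the speed bound gives
|γ(t, y) - y| ≤ K t, and |w - γ(t, y)| ≤ d(w) is at most a multiple of d(w)^(1/β) since d is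
bounded. -/
theorem IsJohnFamily.exists_dist_le_rpow (hJ : IsJohnFamily β Ω x₀ γ lam K C₀) (hβ : 1 ≤ β)
    (hlam : 0 < lam) {M : ℝ} (hM : ∀ x ∈ Ω, bdryDist Ω x ≤ M) (hΩ : IsOpen Ω)
    (hfr : (frontier Ω).Nonempty) :
    ∃ C : ℝ, 0 ≤ C ∧ ∀ y ∈ Ω, ∀ t ∈ Icc (0 : ℝ) 1,
      ∀ w ∈ Metric.ball (γ y t) (3 * coreRadius Ω (γ y t)),
        dist w y ≤ C * bdryDist Ω w ^ (1 / β) := by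
  have hβ0 : 0 < β := by linarith
  have hβ1 : 0 ≤ 1 - 1 / β := by
    rw [sub_nonneg, div_le_one hβ0]; exact hβ
  refine ⟨|M| ^ (1 - 1 / β) + K * (2 / lam) ^ (1 / β), by positivity, ?_⟩
  intro y hy t ht w hw
  have hmem := hJ.mem y hy t ht
  obtain ⟨h1, h2⟩ := bdryDist_bounds_of_mem_ball hw
  have hd := bdryDist_pos hΩ hfr hmem
  have hwΩ := ball_three_coreRadius_subset hΩ hfr hmem hw
  have hdw := bdryDist_pos hΩ hfr hwΩ
  have ht1 : t ≤ (2 / lam) ^ (1 / β) * bdryDist Ω w ^ (1 / β) := by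
    rw [← Real.mul_rpow (by positivity) hdw.le]
    have h3 : t ^ β ≤ 2 / lam * bdryDist Ω w := by
      have := hJ.twisted_cone y hy t ht
      rw [div_mul_eq_mul_div, le_div_iff₀ hlam]
      linarith
    calc t = (t ^ β) ^ (1 / β) := by
          rw [← Real.rpow_mul ht.1, mul_one_div_cancel hβ0.ne', Real.rpow_one]
      _ ≤ _ := Real.rpow_le_rpow (Real.rpow_nonneg ht.1 _) h3 (by positivity)
  have hgt : dist (γ y t) y ≤ K * t := by
    have := (hJ.speed_le y hy).dist_le_mul t ht 0 ⟨le_rfl, zero_le_one⟩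
    rwa [hJ.start y hy, Real.dist_eq, sub_zero, abs_of_nonneg ht.1] at this
  have hwg : dist w (γ y t) ≤ |M| ^ (1 - 1 / β) * bdryDist Ω w ^ (1 / β) := by
    have h3 := Metric.mem_ball.1 hw
    unfold coreRadius at h3
    calc dist w (γ y t) ≤ bdryDist Ω w := by linarith
      _ = bdryDist Ω w ^ (1 - 1 / β) * bdryDist Ω w ^ (1 / β) := by
        rw [← Real.rpow_add hdw, sub_add_cancel, Real.rpow_one]
      _ ≤ _ := by
        gcongr
        exact (hM w hwΩ).trans (le_abs_self M)
  calc dist w y ≤ dist w (γ y t) + dist (γ y t) y := dist_triangle _ _ _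
    _ ≤ |M| ^ (1 - 1 / β) * bdryDist Ω w ^ (1 / β) +
        K * ((2 / lam) ^ (1 / β) * bdryDist Ω w ^ (1 / β)) := by
      refine add_le_add hwg (hgt.trans ?_)
      gcongr
    _ = _ := by ring

/-- The integrand is at most a multiple of t^(-σβ), integrable because σβ < 1. -/
theorem IsJohnFamily.exists_lintegral_speed_le (hJ : IsJohnFamily β Ω x₀ γ lam K C₀)
    (hlam : 0 < lam) {σ : ℝ} (hσ : 0 ≤ σ) (hσβ : σ * β < 1) :
    ∃ C : ℝ≥0∞, C ≠ ⊤ ∧ ∀ y ∈ Ω, ∫⁻ t in Icc (0 : ℝ) 1,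
      ‖deriv (γ y) t‖ₑ * ENNReal.ofReal (bdryDist Ω (γ y t)) ^ (-σ) ≤ C := by
  have hint : IntegrableOn (fun t : ℝ => t ^ (-(σ * β))) (Ioo 0 1) := by
    have := intervalIntegral.intervalIntegrable_rpow' (a := 0) (b := 1) (r := -(σ * β))
      (by linarith)
    rw [intervalIntegrable_iff_integrableOn_Ioo_of_le zero_le_one] at this
    exact this
  have hfin : ∫⁻ t in Ioo (0 : ℝ) 1, ENNReal.ofReal (t ^ (-(σ * β))) ≠ ⊤ := by
    have h := hint.2
    rw [hasFiniteIntegral_iff_enorm] at h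
    refine ne_top_of_le_ne_top h.ne (lintegral_mono fun t => ?_)
    exact Real.ofReal_le_enorm _
  refine ⟨K * ENNReal.ofReal lam ^ (-σ) * ∫⁻ t in Ioo (0 : ℝ) 1, ENNReal.ofReal (t ^ (-(σ * β))),
    ENNReal.mul_ne_top (ENNReal.mul_ne_top ENNReal.coe_ne_top (by simp [hlam])) hfin, ?_⟩
  intro y hy
  rw [← restrict_Ioo_eq_restrict_Icc, ← lintegral_const_mul' _ _ (ENNReal.mul_ne_top
    ENNReal.coe_ne_top (by simp [hlam]))]
  refine setLIntegral_mono' measurableSet_Ioo fun t ht => ?_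
  rw [mul_assoc]
  refine mul_le_mul' ?_ ?_
  · have := norm_deriv_le_of_lipschitzOn (Icc_mem_nhds ht.1 ht.2) (hJ.speed_le y hy)
    rw [← ofReal_norm]
    exact (ENNReal.ofReal_le_ofReal this).trans (by simp)
  · have h1 := hJ.twisted_cone y hy t (Ioo_subset_Icc_self ht)
    have h2 : ENNReal.ofReal (t ^ (-(σ * β))) = (ENNReal.ofReal (t ^ β)) ^ (-σ) := by
      rw [ENNReal.ofReal_rpow_of_pos (Real.rpow_pos_of_pos ht.1 _), ← Real.rpow_mul ht.1.le]
      congr 2; ring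
    rw [h2, ← ENNReal.mul_rpow_of_ne_top ENNReal.ofReal_ne_top ENNReal.ofReal_ne_top,
      ← ENNReal.ofReal_mul hlam.le, ENNReal.rpow_neg, ENNReal.rpow_neg]
    exact ENNReal.inv_le_inv.2 (ENNReal.rpow_le_rpow (ENNReal.ofReal_le_ofReal h1) hσ)

/-- Fubini in (t, w). If w is near γ(t, y), then γ(t, y) lies in B(w, d(w)/2), so condition (4)
bounds the length of the curve that sees w and yields the extra power of d(w). The indicator records
that y is in the shadow of w. -/
theorem IsJohnFamily.exists_lintegral_coreEnergy_le (hJ : IsJohnFamily β Ω x₀ γ lam K C₀)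
    (hβ : 1 ≤ β) (hlam : 0 < lam) (hC₀ : 0 < C₀) (hΩ : IsOpen Ω) (hfr : (frontier Ω).Nonempty)
    (hbd : Bornology.IsBounded Ω) (μ : ℝ) :
    ∃ C : ℝ≥0∞, C ≠ ⊤ ∧ ∃ C₁ : ℝ, 0 ≤ C₁ ∧ ∀ (f : EuclideanSpace ℝ (Fin n) → ℝ) (s p b : ℝ),
      Measurable f → ∀ y ∈ Ω, ∫⁻ t in Icc (0 : ℝ) 1, ‖deriv (γ y) t‖ₑ *
        (ENNReal.ofReal (bdryDist Ω (γ y t)) ^ μ * coreEnergy Ω s p b f (γ y t)) ≤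
      C * ∫⁻ w in Ω, fracEnergy Ω s p b f w * (ENNReal.ofReal (bdryDist Ω w) ^ (μ + 1) *
        {v | dist w v ≤ C₁ * bdryDist Ω w ^ (1 / β)}.indicator 1 y) := by
  obtain ⟨M, -, hM⟩ := exists_bdryDist_le hbd hfr
  obtain ⟨C₁, hC₁, htube⟩ := hJ.exists_dist_le_rpow hβ hlam hM hΩ hfr
  have hCt : (2 : ℝ≥0∞) ^ |μ| * ENNReal.ofReal C₀ ≠ ⊤ := ENNReal.mul_ne_top
    (ENNReal.rpow_ne_top_of_nonneg (abs_nonneg _) (by norm_num)) ENNReal.ofReal_ne_top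
  refine ⟨2 ^ |μ| * ENNReal.ofReal C₀, hCt, C₁, hC₁, ?_⟩
  intro f s p b hf y hy
  -- Nothing is known of `γ y` outside [0, 1]; the constant extension is continuous on ℝ, as joint
  -- measurability requires.
  set c : ℝ → EuclideanSpace ℝ (Fin n) := fun t => γ y (max 0 (min t 1)) with hc
  have hcc : Continuous c := (hJ.speed_le y hy).continuousOn.comp_continuous (by fun_prop)
    fun t => ⟨le_max_left _ _, max_le zero_le_one (min_le_right _ _)⟩
  have hceq : ∀ t ∈ Icc (0 : ℝ) 1, c t = γ y t := fun t ht => by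
    simp only [hc, min_eq_left ht.2, max_eq_right ht.1]
  set D : EuclideanSpace ℝ (Fin n) → ℝ≥0∞ := fun x => ENNReal.ofReal (bdryDist Ω x) with hD
  have hDm : Measurable D := (continuous_bdryDist Ω).measurable.ennreal_ofReal
  have hv : Measurable fun t => ‖deriv (γ y) t‖ₑ := (measurable_deriv _).enorm
  have hH := measurable_fracEnergy (s := s) (p := p) (b := b) hΩ hf
  set S : Set (ℝ × EuclideanSpace ℝ (Fin n)) :=
    {a | dist a.2 (c a.1) < 3 * coreRadius Ω (c a.1)} with hS
  have hSm : MeasurableSet S := measurableSet_lt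
    (measurable_snd.dist (hcc.measurable.comp measurable_fst))
    (((continuous_coreRadius Ω).measurable.comp (hcc.measurable.comp measurable_fst)).const_mul _)
  set G : ℝ → EuclideanSpace ℝ (Fin n) → ℝ≥0∞ := fun t w => S.indicator
    (fun a => ‖deriv (γ y) a.1‖ₑ * D (c a.1) ^ μ * fracEnergy Ω s p b f a.2) (t, w) with hG
  have hGm : Measurable (Function.uncurry G) :=
    (((hv.comp measurable_fst).mul (((hDm.comp hcc.measurable).comp measurable_fst).pow_const μ)).mul
      (hH.comp measurable_snd)).indicator hSm
  have e1 : ∀ t ∈ Icc (0 : ℝ) 1, ‖deriv (γ y) t‖ₑ *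
      (D (γ y t) ^ μ * coreEnergy Ω s p b f (γ y t)) ≤ ∫⁻ w in Ω, G t w := by
    intro t ht
    have hmem := hJ.mem y hy t ht
    have hD0 : D (γ y t) ≠ 0 := ofReal_bdryDist_ne_zero hΩ hfr hmem
    have hDt : D (γ y t) ≠ ⊤ := ENNReal.ofReal_ne_top
    rw [← mul_assoc, coreEnergy, ← lintegral_const_mul' _ _
      (ENNReal.mul_ne_top enorm_ne_top (by simp [hD0, hDt]))]
    refine le_trans (setLIntegral_mono' (g := G t) measurableSet_ball fun w hw => ?_)
      (lintegral_mono_set (ball_three_coreRadius_subset hΩ hfr hmem))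
    have hwS : (t, w) ∈ S := by
      change dist w (c t) < 3 * coreRadius Ω (c t)
      rw [hceq t ht]
      exact Metric.mem_ball.1 hw
    simp only [hG, hwS, indicator_of_mem, hceq t ht, le_refl]
  have e2 : ∀ w ∈ Ω, ∫⁻ t in Icc (0 : ℝ) 1, G t w ≤ 2 ^ |μ| * ENNReal.ofReal C₀ *
      (fracEnergy Ω s p b f w * (D w ^ (μ + 1) *
        {v | dist w v ≤ C₁ * bdryDist Ω w ^ (1 / β)}.indicator 1 y)) := by
    intro w hw
    have hd := bdryDist_pos hΩ hfr hw
    have hD0 : D w ≠ 0 := ofReal_bdryDist_ne_zero hΩ hfr hw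
    have hDt : D w ≠ ⊤ := ENNReal.ofReal_ne_top
    set I : ℝ≥0∞ := {v | dist w v ≤ C₁ * bdryDist Ω w ^ (1 / β)}.indicator 1 y with hI
    have hle : ∀ t ∈ Icc (0 : ℝ) 1, G t w ≤
        {t ∈ Icc (0 : ℝ) 1 | γ y t ∈ Metric.ball w (bdryDist Ω w / 2)}.indicator
          (fun t => ‖deriv (γ y) t‖ₑ * (2 ^ |μ| * D w ^ μ * fracEnergy Ω s p b f w * I)) t := by
      intro t ht
      by_cases hwS : (t, w) ∈ S
      · have hwb : w ∈ Metric.ball (γ y t) (3 * coreRadius Ω (γ y t)) := by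
          have : dist w (c t) < 3 * coreRadius Ω (c t) := hwS
          rw [hceq t ht] at this
          exact this
        obtain ⟨h1, h2⟩ := bdryDist_bounds_of_mem_ball hwb
        have hI1 : I = 1 := by
          have : y ∈ {v | dist w v ≤ C₁ * bdryDist Ω w ^ (1 / β)} := htube y hy t ht w hwb
          rw [hI, indicator_of_mem this, Pi.one_apply]
        have hmem : t ∈ {t ∈ Icc (0 : ℝ) 1 | γ y t ∈ Metric.ball w (bdryDist Ω w / 2)} := by
          refine ⟨ht, ?_⟩
          have h3 := Metric.mem_ball'.1 hwb
          unfold coreRadius at h3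
          rw [Metric.mem_ball]
          linarith
        rw [indicator_of_mem hmem, hI1, mul_one]
        simp only [hG, hwS, indicator_of_mem, hceq t ht]
        rw [mul_assoc]
        gcongr
        exact ENNReal.rpow_le_mul_rpow_of_le_of_le (by norm_num) (by norm_num)
          (ofReal_bdryDist_le_two_mul (by linarith)) (ofReal_bdryDist_le_two_mul (by linarith)) _
      · simp [hG, hwS]
    refine (setLIntegral_mono' measurableSet_Icc hle).trans ?_
    refine (setLIntegral_le_lintegral _ _).trans ((lintegral_indicator_le _ _).trans ?_)
    rw [lintegral_mul_const _ hv]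
    have hlen := hJ.length_le w hw y hy (bdryDist Ω w / 2) le_rfl
    rw [lengthInside] at hlen
    have hlen2 : ENNReal.ofReal (C₀ * (bdryDist Ω w / 2)) ≤ ENNReal.ofReal C₀ * D w := by
      rw [ENNReal.ofReal_mul hC₀.le]
      refine mul_le_mul_right (ENNReal.ofReal_le_ofReal (by linarith)) _
    calc _ ≤ ENNReal.ofReal C₀ * D w * (2 ^ |μ| * D w ^ μ * fracEnergy Ω s p b f w * I) :=
          mul_le_mul_left (hlen.trans hlen2) _
      _ = _ := by
        rw [ENNReal.rpow_add _ _ hD0 hDt, ENNReal.rpow_one]; ring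
  calc _ ≤ ∫⁻ t in Icc (0 : ℝ) 1, ∫⁻ w in Ω, G t w := setLIntegral_mono' measurableSet_Icc e1
    _ = ∫⁻ w in Ω, ∫⁻ t in Icc (0 : ℝ) 1, G t w := lintegral_lintegral_swap hGm.aemeasurable
    _ ≤ _ := by
      rw [← lintegral_const_mul' _ _ hCt]
      exact setLIntegral_mono' hΩ.measurableSet e2

theorem IsJohnFamily.exists_enorm_tentAverage_sub_rpow_le
    (hJ : IsJohnFamily β Ω x₀ γ lam K C₀) (hβ : 1 ≤ β) (hlam : 0 < lam) (hC₀ : 0 < C₀)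
    (hΩ : IsOpen Ω) (hfr : (frontier Ω).Nonempty) (hbd : Bornology.IsBounded Ω)
    {s p b σ : ℝ} (hp : 1 ≤ p) (hs : 0 ≤ s) (hσ : 0 ≤ σ) (hσβ : σ * β < 1) :
    ∃ C : ℝ≥0∞, C ≠ ⊤ ∧ ∃ C₁ : ℝ, 0 ≤ C₁ ∧ ∀ f : EuclideanSpace ℝ (Fin n) → ℝ,
      Measurable f → ContinuousOn f Ω → ∫⁻ w in Ω, fracEnergy Ω s p b f w ≠ ⊤ → ∀ y ∈ Ω,
        ‖tentAverage Ω f y - tentAverage Ω f x₀‖ₑ ^ p ≤ C * ∫⁻ w in Ω, fracEnergy Ω s p b f w *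
          (ENNReal.ofReal (bdryDist Ω w) ^ (σ * (p - 1) + s * p - p - n - b + 1) *
            {v | dist w v ≤ C₁ * bdryDist Ω w ^ (1 / β)}.indicator 1 y) := by
  have hp0 : 0 < p := by linarith
  obtain ⟨M, hM1, hM⟩ := exists_bdryDist_le hbd hfr
  obtain ⟨C₂, hC₂, H₂⟩ := _root_.exists_enorm_tentAverage_sub_rpow_le n hp hs b
  obtain ⟨C₃, hC₃, H₃⟩ := hJ.exists_lintegral_speed_le hlam hσ hσβ
  obtain ⟨C₄, hC₄, C₁, hC₁, H₄⟩ := hJ.exists_lintegral_coreEnergy_le hβ hlam hC₀ hΩ hfr hbd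
    (σ * (p - 1) + s * p - p - n - b)
  have hC₃p : C₃ ^ (p - 1) ≠ ⊤ := ENNReal.rpow_ne_top_of_nonneg (by linarith) hC₃
  refine ⟨C₃ ^ (p - 1) * (C₂ * C₄), ENNReal.mul_ne_top hC₃p (ENNReal.mul_ne_top hC₂ hC₄),
    C₁, hC₁, ?_⟩
  intro f hf hfc hfin y hy
  set m := ∫⁻ w in Ω, fracEnergy Ω s p b f w with hm
  set c : ℝ → EuclideanSpace ℝ (Fin n) := fun t => γ y (max 0 (min t 1)) with hc
  have hcont := (hJ.speed_le y hy).continuousOn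
  have hcc : Continuous c := hcont.comp_continuous (by fun_prop)
    fun t => ⟨le_max_left _ _, max_le zero_le_one (min_le_right _ _)⟩
  have hceq : ∀ t ∈ Icc (0 : ℝ) 1, c t = γ y t := fun t ht => by
    simp only [hc, min_eq_left ht.2, max_eq_right ht.1]
  obtain ⟨t₀, ht₀, hmin⟩ := isCompact_Icc.exists_isMinOn (nonempty_Icc.2 (zero_le_one (α := ℝ)))
    ((continuous_bdryDist Ω).comp_continuousOn hcont)
  set d₀ := bdryDist Ω (γ y t₀) with hd₀
  have hd₀0 : 0 < d₀ := bdryDist_pos hΩ hfr (hJ.mem y hy t₀ ht₀)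
  have hd₀le : ∀ t ∈ Icc (0 : ℝ) 1, d₀ ≤ bdryDist Ω (γ y t) := fun t ht => hmin ht
  set D : ℝ → ℝ≥0∞ := fun t => ENNReal.ofReal (bdryDist Ω (c t)) with hD
  have hDm : Measurable D :=
    ((continuous_bdryDist Ω).comp hcc).measurable.ennreal_ofReal
  have hD0 : ∀ t ∈ Icc (0 : ℝ) 1, D t ≠ 0 := fun t ht => by
    simp only [hD, hceq t ht]
    exact ofReal_bdryDist_ne_zero hΩ hfr (hJ.mem y hy t ht)
  have hDt : ∀ t, D t ≠ ⊤ := fun t => ENNReal.ofReal_ne_top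
  set Λ : ℝ → ℝ≥0∞ := fun t =>
    (C₂ * (D t ^ (s * p - p - n - b) * coreEnergy Ω s p b f (c t))) ^ (1 / p) with hΛ
  have hΛm : Measurable Λ := (((hDm.pow_const _).mul
    ((measurable_coreEnergy hΩ hf).comp hcc.measurable)).const_mul _).pow_const _
  -- A crude bound for Λ, finite because the total energy is. The sum covers both signs of the
  -- exponent, since d₀ ≤ d ≤ M along the curve.
  set B : ℝ≥0∞ := (C₂ * ((ENNReal.ofReal M ^ (s * p - p - n - b) +
    ENNReal.ofReal d₀ ^ (s * p - p - n - b)) * m)) ^ (1 / p) with hB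
  have hBt : B ≠ ⊤ := by
    have hM0 : 0 < M := by linarith
    refine ENNReal.rpow_ne_top_of_nonneg (by positivity) (ENNReal.mul_ne_top hC₂
      (ENNReal.mul_ne_top (ENNReal.add_ne_top.2 ⟨?_, ?_⟩) hfin))
    · simp [hM0]
    · simp [hd₀0]
  have hΛB : ∀ t ∈ Icc (0 : ℝ) 1, Λ t ≤ B := by
    intro t ht
    have hmem := hJ.mem y hy t ht
    have h1 : D t ^ (s * p - p - n - b) ≤ ENNReal.ofReal M ^ (s * p - p - n - b) +
        ENNReal.ofReal d₀ ^ (s * p - p - n - b) := by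
      have hl : ENNReal.ofReal d₀ ≤ D t := by
        simp only [hD, hceq t ht]; exact ENNReal.ofReal_le_ofReal (hd₀le t ht)
      have hu : D t ≤ ENNReal.ofReal M := by
        simp only [hD, hceq t ht]; exact ENNReal.ofReal_le_ofReal (hM _ hmem)
      rcases le_total 0 (s * p - p - n - b) with h | h
      · exact (ENNReal.rpow_le_rpow hu h).trans le_self_add
      · exact (ENNReal.rpow_le_rpow_of_le_of_nonpos h hl).trans le_add_self
    have h2 : coreEnergy Ω s p b f (c t) ≤ m := by
      rw [hceq t ht]; exact coreEnergy_le hΩ hfr hmem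
    simp only [hΛ, hB]
    gcongr
  have hA : ∀ t ∈ Icc (0 : ℝ) 1, ∀ x', dist x' (γ y t) ≤ d₀ / 20 →
      ‖tentAverage Ω f x' - tentAverage Ω f (γ y t)‖ₑ ≤
        Λ t * ENNReal.ofReal (dist x' (γ y t)) := by
    intro t ht x' hx'
    have h1 := H₂ Ω hΩ hfr f hf hfc (γ y t) (hJ.mem y hy t ht) x' (hx'.trans (by
      unfold coreRadius; linarith [hd₀le t ht]))
    have h2 := ENNReal.rpow_le_rpow h1 (by positivity : 0 ≤ 1 / p)
    rw [← ENNReal.rpow_mul, mul_one_div_cancel hp0.ne', ENNReal.rpow_one] at h2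
    refine h2.trans (le_of_eq ?_)
    simp only [hΛ, hD, hceq t ht]
    rw [mul_left_comm, ENNReal.mul_rpow_of_nonneg _ _ (by positivity : 0 ≤ 1 / p),
      ← ENNReal.rpow_mul, mul_one_div_cancel hp0.ne', ENNReal.rpow_one, mul_comm]
  have hftc := enorm_sub_le_lintegral_of_locally_lipschitz (hJ.speed_le y hy)
    (A := tentAverage Ω f) (by positivity : 0 < d₀ / 20) (Λ := Λ) (B := B.toNNReal)
    (by rwa [ENNReal.coe_toNNReal hBt]) hA
  rw [hJ.start y hy, hJ.finish y hy, enorm_sub_rev] at hftc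
  have hv : Measurable fun t => ‖deriv (γ y) t‖ₑ := (measurable_deriv _).enorm
  -- Inserting d^(-σ) d^σ makes speed times d^(-σ) the measure for Jensen, and contributes σ(p-1) to
  -- the exponent of d.
  have hsplit : ∫⁻ t in Icc (0 : ℝ) 1, Λ t * ‖deriv (γ y) t‖ₑ =
      ∫⁻ t in Icc (0 : ℝ) 1, (‖deriv (γ y) t‖ₑ * D t ^ (-σ)) * (Λ t * D t ^ σ) := by
    refine setLIntegral_congr_fun measurableSet_Icc fun t ht => ?_
    calc Λ t * ‖deriv (γ y) t‖ₑ = ‖deriv (γ y) t‖ₑ * (D t ^ (-σ) * D t ^ σ) * Λ t := by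
          rw [← ENNReal.rpow_add _ _ (hD0 t ht) (hDt t)]; simp [mul_comm]
      _ = _ := by ring
  have hspeed : ∫⁻ t in Icc (0 : ℝ) 1, ‖deriv (γ y) t‖ₑ * D t ^ (-σ) ≤ C₃ := by
    refine le_trans (le_of_eq (setLIntegral_congr_fun measurableSet_Icc fun t ht => ?_)) (H₃ y hy)
    simp only [hD, hceq t ht]
  calc ‖tentAverage Ω f y - tentAverage Ω f x₀‖ₑ ^ p
      ≤ (∫⁻ t in Icc (0 : ℝ) 1, (‖deriv (γ y) t‖ₑ * D t ^ (-σ)) * (Λ t * D t ^ σ)) ^ p := by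
        rw [← hsplit]; exact ENNReal.rpow_le_rpow hftc hp0.le
    _ ≤ (∫⁻ t in Icc (0 : ℝ) 1, ‖deriv (γ y) t‖ₑ * D t ^ (-σ)) ^ (p - 1) *
        ∫⁻ t in Icc (0 : ℝ) 1, (‖deriv (γ y) t‖ₑ * D t ^ (-σ)) * (Λ t * D t ^ σ) ^ p :=
      rpow_lintegral_mul_le hp (hΛm.mul (hDm.pow_const σ)) (hv.mul (hDm.pow_const (-σ)))
    _ ≤ C₃ ^ (p - 1) * ∫⁻ t in Icc (0 : ℝ) 1, C₂ * (‖deriv (γ y) t‖ₑ *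
        (ENNReal.ofReal (bdryDist Ω (γ y t)) ^ (σ * (p - 1) + s * p - p - n - b) *
          coreEnergy Ω s p b f (γ y t))) := by
      refine mul_le_mul' (ENNReal.rpow_le_rpow hspeed (by linarith)) (le_of_eq ?_)
      refine setLIntegral_congr_fun measurableSet_Icc fun t ht => ?_
      have h0 := hD0 t ht
      have ht' := hDt t
      have hΛp : Λ t ^ p = C₂ * (D t ^ (s * p - p - n - b) * coreEnergy Ω s p b f (γ y t)) := by
        simp only [hΛ]
        rw [← ENNReal.rpow_mul, one_div_mul_cancel hp0.ne', ENNReal.rpow_one, hceq t ht]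
      have hDe : ENNReal.ofReal (bdryDist Ω (γ y t)) = D t := by simp only [hD, hceq t ht]
      rw [hDe, ENNReal.mul_rpow_of_nonneg _ _ hp0.le, hΛp, ← ENNReal.rpow_mul,
        show σ * (p - 1) + s * p - p - n - b = -σ + σ * p + (s * p - p - n - b) by ring,
        ENNReal.rpow_add _ _ h0 ht', ENNReal.rpow_add _ _ h0 ht']
      ring
    _ ≤ _ := by
      rw [lintegral_const_mul' _ _ hC₂, mul_assoc, mul_assoc]
      exact mul_le_mul_right (mul_le_mul_right (H₄ f s p b hf y hy) _) _

end Chain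

/-! ### Integration over the domain -/

section Global

variable {n : ℕ} {Ω : Set (EuclideanSpace ℝ (Fin n))} {β : ℝ}

/-- The shadow of w lies in a ball of radius ρ comparable to d(w)^(1/β), on which d ≤ ρ; as a ≥ 0,
its weighted mass is at most a multiple of ρ^(n+a). -/
theorem exists_setLIntegral_indicator_le (hβ : 1 ≤ β) (hΩ : IsOpen Ω)
    (hfr : (frontier Ω).Nonempty) {M C₁ : ℝ} (hM1 : 1 ≤ M) (hM : ∀ x ∈ Ω, bdryDist Ω x ≤ M)
    (hC₁ : 0 ≤ C₁) {a : ℝ} (ha : 0 ≤ a) :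
    ∃ C : ℝ≥0∞, C ≠ ⊤ ∧ ∀ w ∈ Ω, ∫⁻ y in Ω, ENNReal.ofReal (bdryDist Ω y) ^ a *
      {v | dist w v ≤ C₁ * bdryDist Ω w ^ (1 / β)}.indicator 1 y ≤
        C * ENNReal.ofReal (bdryDist Ω w) ^ ((n + a) / β) := by
  have hβ0 : 0 < β := by linarith
  have hβ1 : 0 ≤ 1 - 1 / β := by
    rw [sub_nonneg, div_le_one hβ0]; exact hβ
  set R := M ^ (1 - 1 / β) + C₁ + 1 with hR
  have hM0 : 0 ≤ M ^ (1 - 1 / β) := Real.rpow_nonneg (by linarith) _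
  have hR0 : 0 < R := by positivity
  refine ⟨ENNReal.ofReal R ^ (a + n) * volume (Metric.ball (0 : EuclideanSpace ℝ (Fin n)) 1),
    ENNReal.mul_ne_top (ENNReal.rpow_ne_top_of_nonneg (by positivity) ENNReal.ofReal_ne_top)
      measure_ball_lt_top.ne, ?_⟩
  intro w hw
  have hd := bdryDist_pos hΩ hfr hw
  have hdβ : 0 < bdryDist Ω w ^ (1 / β) := Real.rpow_pos_of_pos hd _
  set ρ := R * bdryDist Ω w ^ (1 / β) with hρ
  have hρ0 : 0 < ρ := by positivity
  have hwM : bdryDist Ω w ≤ M ^ (1 - 1 / β) * bdryDist Ω w ^ (1 / β) := by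
    calc bdryDist Ω w = bdryDist Ω w ^ (1 - 1 / β) * bdryDist Ω w ^ (1 / β) := by
          rw [← Real.rpow_add hd, sub_add_cancel, Real.rpow_one]
      _ ≤ _ := by gcongr; exact hM w hw
  have hle : ∀ y ∈ Ω, ENNReal.ofReal (bdryDist Ω y) ^ a *
      {v | dist w v ≤ C₁ * bdryDist Ω w ^ (1 / β)}.indicator 1 y ≤
      (Metric.ball w ρ).indicator (fun _ => ENNReal.ofReal ρ ^ a) y := by
    intro y _
    by_cases hy : y ∈ {v | dist w v ≤ C₁ * bdryDist Ω w ^ (1 / β)}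
    · have hy' : dist w y ≤ C₁ * bdryDist Ω w ^ (1 / β) := hy
      have hyb : y ∈ Metric.ball w ρ := by
        rw [Metric.mem_ball, dist_comm]
        refine hy'.trans_lt ?_
        rw [hρ, hR]
        gcongr
        linarith
      rw [indicator_of_mem hy, indicator_of_mem hyb, Pi.one_apply, mul_one]
      refine ENNReal.rpow_le_rpow (ENNReal.ofReal_le_ofReal ?_) ha
      have h1 := bdryDist_le_add_dist Ω y w
      rw [dist_comm] at h1
      have h2 : ρ = M ^ (1 - 1 / β) * bdryDist Ω w ^ (1 / β) + C₁ * bdryDist Ω w ^ (1 / β) +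
        bdryDist Ω w ^ (1 / β) := by rw [hρ, hR]; ring
      linarith
    · rw [indicator_of_notMem hy, mul_zero]
      exact zero_le
  refine (setLIntegral_mono' hΩ.measurableSet hle).trans
    ((setLIntegral_le_lintegral _ _).trans (le_of_eq ?_))
  have hρt : ENNReal.ofReal ρ ≠ ⊤ := ENNReal.ofReal_ne_top
  rw [lintegral_indicator measurableSet_ball, setLIntegral_const, volume_ball_eq_rpow w hρ0,
    ← mul_assoc, ← ENNReal.rpow_add _ _ (by simpa using hρ0) hρt, hρ, ENNReal.ofReal_mul hR0.le,
    ENNReal.mul_rpow_of_nonneg _ _ (by positivity), ← ENNReal.ofReal_rpow_of_pos hd,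
    ← ENNReal.rpow_mul, show 1 / β * (a + n) = (n + a) / β by ring]
  ring

/-- Jensen with exponent q/p against the energy density moves the power inside the integral, where
the indicator is unaffected. Tonelli and the shadow mass then leave d(w)^e, and `hb` says precisely
that e ≥ 0. -/
theorem IsJohnFamily.exists_lintegral_tentAverage_sub_rpow_le {x₀ : EuclideanSpace ℝ (Fin n)}
    {γ : EuclideanSpace ℝ (Fin n) → ℝ → EuclideanSpace ℝ (Fin n)} {lam C₀ : ℝ} {K : ℝ≥0}
    (hJ : IsJohnFamily β Ω x₀ γ lam K C₀) (hβ : 1 ≤ β) (hlam : 0 < lam) (hC₀ : 0 < C₀)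
    (hΩ : IsOpen Ω) (hfr : (frontier Ω).Nonempty) (hbd : Bornology.IsBounded Ω)
    {s p q a b σ : ℝ} (hp : 1 ≤ p) (hpq : p ≤ q) (hs : 0 ≤ s) (ha : 0 ≤ a) (hσ : 0 ≤ σ)
    (hσβ : σ * β < 1)
    (hb : b ≤ (n + a) * p / (q * β) + σ * (p - 1) + s * p - p + 1 - n) :
    ∃ C : ℝ≥0∞, C ≠ ⊤ ∧ ∀ f : EuclideanSpace ℝ (Fin n) → ℝ,
      Measurable f → ContinuousOn f Ω → ∫⁻ w in Ω, fracEnergy Ω s p b f w ≠ ⊤ →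
        ∫⁻ y in Ω, ‖tentAverage Ω f y - tentAverage Ω f x₀‖ₑ ^ q *
          ENNReal.ofReal (bdryDist Ω y) ^ a ≤
          C * (∫⁻ w in Ω, fracEnergy Ω s p b f w) ^ (q / p) := by
  have hp0 : 0 < p := by linarith
  have hq0 : 0 < q := by linarith
  have hβ0 : 0 < β := by linarith
  have hqp0 : 0 < q / p := by positivity
  have hqp1 : 1 ≤ q / p := by rw [one_le_div hp0]; exact hpq
  obtain ⟨M, hM1, hM⟩ := exists_bdryDist_le hbd hfr
  obtain ⟨C₂, hC₂, C₁, hC₁, H₂⟩ := hJ.exists_enorm_tentAverage_sub_rpow_le (b := b) hβ hlam hC₀ hΩ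
    hfr hbd hp hs hσ hσβ
  obtain ⟨C₃, hC₃, H₃⟩ := exists_setLIntegral_indicator_le hβ hΩ hfr hM1 hM hC₁ ha
  set E := σ * (p - 1) + s * p - p - n - b + 1 with hE
  set e := E * (q / p) + (n + a) / β with he
  have he0 : 0 ≤ e := by
    have h1 : -((n + a) * p / (q * β)) ≤ E := by rw [hE]; linarith
    have h2 : -((n + a) * p / (q * β)) * (q / p) ≤ E * (q / p) := by gcongr
    have h3 : -((n + a) * p / (q * β)) * (q / p) = -((n + a) / β) := by field_simp
    rw [he]; linarith
  set Me := ENNReal.ofReal M ^ e with hMe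
  have hMet : Me ≠ ⊤ := ENNReal.rpow_ne_top_of_nonneg he0 ENNReal.ofReal_ne_top
  refine ⟨C₂ ^ (q / p) * (C₃ * Me), ENNReal.mul_ne_top (ENNReal.rpow_ne_top_of_nonneg hqp0.le hC₂)
    (ENNReal.mul_ne_top hC₃ hMet), ?_⟩
  intro f hf hfc hfin
  set m := ∫⁻ w in Ω, fracEnergy Ω s p b f w with hm
  set D : EuclideanSpace ℝ (Fin n) → ℝ≥0∞ := fun x => ENNReal.ofReal (bdryDist Ω x) with hD
  have hdm : Measurable (bdryDist Ω) := (continuous_bdryDist Ω).measurable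
  have hDm : Measurable D := hdm.ennreal_ofReal
  have hH := measurable_fracEnergy (s := s) (p := p) (b := b) hΩ hf
  set I : EuclideanSpace ℝ (Fin n) → EuclideanSpace ℝ (Fin n) → ℝ≥0∞ :=
    fun w y => {v | dist w v ≤ C₁ * bdryDist Ω w ^ (1 / β)}.indicator 1 y with hI
  have hIm : Measurable (Function.uncurry I) := by
    have hT : MeasurableSet {v : EuclideanSpace ℝ (Fin n) × EuclideanSpace ℝ (Fin n) |
        dist v.1 v.2 ≤ C₁ * bdryDist Ω v.1 ^ (1 / β)} :=
      measurableSet_le (measurable_fst.dist measurable_snd)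
        (((hdm.comp measurable_fst).pow_const _).const_mul _)
    have heq : Function.uncurry I = indicator {v : EuclideanSpace ℝ (Fin n) ×
        EuclideanSpace ℝ (Fin n) | dist v.1 v.2 ≤ C₁ * bdryDist Ω v.1 ^ (1 / β)} 1 := by
      ext ⟨w, y⟩
      simp only [Function.uncurry_apply_pair, hI, indicator, mem_ofPred_eq, Pi.one_apply]
    rw [heq]
    exact measurable_one.indicator hT
  have hIpow : ∀ w y, I w y ^ (q / p) = I w y := by
    intro w y
    simp only [hI, indicator]
    split_ifs <;> simp [hqp0]
  have H₂I : ∀ y ∈ Ω, ‖tentAverage Ω f y - tentAverage Ω f x₀‖ₑ ^ p ≤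
      C₂ * ∫⁻ w in Ω, fracEnergy Ω s p b f w * (D w ^ E * I w y) := H₂ f hf hfc hfin
  have H₃I : ∀ w ∈ Ω, ∫⁻ y in Ω, D y ^ a * I w y ≤ C₃ * D w ^ ((n + a) / β) := H₃
  clear_value I
  have hpt : ∀ y ∈ Ω, ‖tentAverage Ω f y - tentAverage Ω f x₀‖ₑ ^ q * D y ^ a ≤
      C₂ ^ (q / p) * m ^ (q / p - 1) *
        ∫⁻ w in Ω, fracEnergy Ω s p b f w * D w ^ (E * (q / p)) * (D y ^ a * I w y) := by
    intro y hy
    have h1 := ENNReal.rpow_le_rpow (H₂I y hy) hqp0.le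
    rw [← ENNReal.rpow_mul, mul_div_cancel₀ _ hp0.ne', ENNReal.mul_rpow_of_nonneg _ _ hqp0.le] at h1
    have h2 := rpow_lintegral_mul_le (μ := volume.restrict Ω) hqp1
      (F := fun w => D w ^ E * I w y) (H := fracEnergy Ω s p b f)
      ((hDm.pow_const _).mul hIm.of_uncurry_right) hH
    calc _ ≤ C₂ ^ (q / p) * (m ^ (q / p - 1) *
          ∫⁻ w in Ω, fracEnergy Ω s p b f w * (D w ^ E * I w y) ^ (q / p)) * D y ^ a :=
          mul_le_mul_left (h1.trans (mul_le_mul_right h2 _)) _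
      _ = C₂ ^ (q / p) * m ^ (q / p - 1) *
          (D y ^ a * ∫⁻ w in Ω, fracEnergy Ω s p b f w * (D w ^ E * I w y) ^ (q / p)) := by ring
      _ = _ := by
        rw [← lintegral_const_mul' _ _ (ENNReal.rpow_ne_top_of_nonneg ha ENNReal.ofReal_ne_top)]
        congr 1
        refine lintegral_congr fun w => ?_
        rw [ENNReal.mul_rpow_of_nonneg _ _ hqp0.le, hIpow, ← ENNReal.rpow_mul]
        ring
  have hct : C₂ ^ (q / p) * m ^ (q / p - 1) ≠ ⊤ := ENNReal.mul_ne_top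
    (ENNReal.rpow_ne_top_of_nonneg hqp0.le hC₂) (ENNReal.rpow_ne_top_of_nonneg (by linarith) hfin)
  have hGm : Measurable (Function.uncurry fun y w =>
      fracEnergy Ω s p b f w * D w ^ (E * (q / p)) * (D y ^ a * I w y)) :=
    ((hH.comp measurable_snd).mul ((hDm.comp measurable_snd).pow_const _)).mul
      (((hDm.comp measurable_fst).pow_const _).mul (hIm.comp measurable_swap))
  have hw : ∀ w ∈ Ω, ∫⁻ y in Ω,
      fracEnergy Ω s p b f w * D w ^ (E * (q / p)) * (D y ^ a * I w y) ≤
      C₃ * Me * fracEnergy Ω s p b f w := by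
    intro w hw
    have hD0 : D w ≠ 0 := ofReal_bdryDist_ne_zero hΩ hfr hw
    have hDt : D w ≠ ⊤ := ENNReal.ofReal_ne_top
    rw [lintegral_const_mul _ (f := fun y => D y ^ a * I w y)
      ((hDm.pow_const a).mul hIm.of_uncurry_left)]
    calc _ ≤ fracEnergy Ω s p b f w * D w ^ (E * (q / p)) * (C₃ * D w ^ ((n + a) / β)) :=
          mul_le_mul_right (H₃I w hw) _
      _ = C₃ * D w ^ e * fracEnergy Ω s p b f w := by
        rw [he, ENNReal.rpow_add _ _ hD0 hDt]; ring
      _ ≤ _ := by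
        rw [hMe]
        gcongr
        exact ENNReal.ofReal_le_ofReal (hM w hw)
  calc _ ≤ ∫⁻ y in Ω, C₂ ^ (q / p) * m ^ (q / p - 1) *
        ∫⁻ w in Ω, fracEnergy Ω s p b f w * D w ^ (E * (q / p)) * (D y ^ a * I w y) :=
        setLIntegral_mono' hΩ.measurableSet hpt
    _ = C₂ ^ (q / p) * m ^ (q / p - 1) * ∫⁻ w in Ω, ∫⁻ y in Ω,
        fracEnergy Ω s p b f w * D w ^ (E * (q / p)) * (D y ^ a * I w y) := by
      rw [lintegral_const_mul' _ _ hct, lintegral_lintegral_swap hGm.aemeasurable]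
    _ ≤ C₂ ^ (q / p) * m ^ (q / p - 1) * ∫⁻ w in Ω, C₃ * Me * fracEnergy Ω s p b f w :=
      mul_le_mul_right (setLIntegral_mono' hΩ.measurableSet hw) _
    _ = C₂ ^ (q / p) * (C₃ * Me) * (m ^ (q / p - 1) * m ^ (1 : ℝ)) := by
      rw [lintegral_const_mul' _ _ (ENNReal.mul_ne_top hC₃ hMet), ENNReal.rpow_one]; ring
    _ = _ := by
      rw [← ENNReal.rpow_add_of_nonneg _ _ (by linarith) zero_le_one, sub_add_cancel]

theorem fracSeminorm_eq (Ω : Set (EuclideanSpace ℝ (Fin n))) (s p b : ℝ)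
    (f : EuclideanSpace ℝ (Fin n) → ℝ) :
    fracSeminorm Ω s p b f = (∫⁻ x in Ω, fracEnergy Ω s p b f x) ^ (1 / p) := rfl

theorem fracSeminorm_congr (hΩ : IsOpen Ω) {s p b : ℝ} {f g : EuclideanSpace ℝ (Fin n) → ℝ}
    (hfg : EqOn f g Ω) : fracSeminorm Ω s p b f = fracSeminorm Ω s p b g := by
  rw [fracSeminorm_eq, fracSeminorm_eq]
  congr 1
  refine setLIntegral_congr_fun hΩ.measurableSet fun x hx => ?_
  have hS : MeasurableSet {z | z ∈ Ω ∧ ‖x - z‖ ≤ bdryDist Ω x / 2} :=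
    hΩ.measurableSet.inter (measurableSet_le (measurable_const.sub measurable_id).norm
      measurable_const)
  refine setLIntegral_congr_fun hS fun z hz => ?_
  simp only [fracKernel, hfg hx, hfg hz.1]

theorem eLpNorm_weightedMeasure (Ω : Set (EuclideanSpace ℝ (Fin n))) {q a : ℝ} (hq : 0 < q) (ha : 0 ≤ a)
    (g : EuclideanSpace ℝ (Fin n) → ℝ) :
    eLpNorm g (ENNReal.ofReal q) (weightedMeasure Ω a) =
      (∫⁻ y in Ω, ‖g y‖ₑ ^ q * ENNReal.ofReal (bdryDist Ω y) ^ a) ^ (1 / q) := by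
  rw [eLpNorm_eq_lintegral_rpow_enorm_toReal (by simpa using hq) ENNReal.ofReal_ne_top,
    ENNReal.toReal_ofReal hq.le, weightedMeasure, lintegral_withDensity_eq_lintegral_mul_non_measurable]
  · congr 1
    refine lintegral_congr fun y => ?_
    rw [Pi.mul_apply, mul_comm, ENNReal.ofReal_rpow_of_nonneg bdryDist_nonneg ha]
  · exact ((continuous_bdryDist Ω).measurable.pow_const a).ennreal_ofReal
  · exact Filter.Eventually.of_forall fun _ => ENNReal.ofReal_lt_top

end Global

/-! ### The main theorem -/

theorem mainTheorem5 {n : ℕ} (hn : 2 ≤ n) (Ω : Set (EuclideanSpace ℝ (Fin n))) (β : ℝ)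
    (hΩ : IsJohnDomain β Ω) (s p q a b : ℝ) (hs0 : 0 < s) (hs1 : s < 1)
    (hp : 1 < p) (hpq : p ≤ q) (ha : 0 ≤ a)
    (hb : b < ((n : ℝ) + a) * p / (q * β) + (p - 1) / β + s * p - p + 1 - (n : ℝ))
    (hq : p < (n : ℝ) / s → q ≤ (n : ℝ) * p / ((n : ℝ) - s * p)) :
    ∃ C : ℝ, 0 < C ∧ ∀ f : EuclideanSpace ℝ (Fin n) → ℝ, ContDiffOn ℝ ∞ f Ω →
      (⨅ c : ℝ, eLpNorm (fun y => f y - c) (ENNReal.ofReal q) (weightedMeasure Ω a)) ≤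
        ENNReal.ofReal C * fracSeminorm Ω s p b f := by
  have hn0 : 0 < n := by omega
  have hp0 : 0 < p := by linarith
  have hq0 : 0 < q := by linarith
  obtain ⟨hopen, hconn, hbd, hβ, x₀, hx₀, γ, lam, K, C₀, hlam, hK, hC₀, hJ⟩ := hΩ
  have hβ0 : 0 < β := by linarith
  have hfr : (frontier Ω).Nonempty := frontier_nonempty_of_isBounded hn0 ⟨x₀, hx₀⟩ hbd
  have hsq : n - n * p / q ≤ s * p := by
    rcases lt_or_ge p (n / s) with h | h
    · have h1 : 0 < n - s * p := by
        rw [lt_div_iff₀ hs0] at h; linarith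
      have h2 := hq h
      rw [le_div_iff₀ h1] at h2
      have h3 : n - s * p ≤ n * p / q := by rw [le_div_iff₀ hq0]; linarith
      linarith
    · rw [div_le_iff₀ hs0] at h
      have : 0 ≤ n * p / q := by positivity
      linarith
  -- The local condition is the bound on b with β replaced by 1, which is weaker because β ≥ 1.
  have hab : b ≤ (n + a) * p / q + s * p - n := by
    have h1 : (n + a) * p / (q * β) ≤ (n + a) * p / q := by
      gcongr
      exact le_mul_of_one_le_right hq0.le hβ
    have h2 : (p - 1) / β ≤ p - 1 := div_le_self (by linarith) hβ
    linarith
  obtain ⟨σ, hσ, hσβ, hbσ⟩ : ∃ σ, 0 ≤ σ ∧ σ * β < 1 ∧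
      b ≤ (n + a) * p / (q * β) + σ * (p - 1) + s * p - p + 1 - n := by
    set τ := (n + a) * p / (q * β) + (p - 1) / β + s * p - p + 1 - n - b with hτ
    have hτ0 : 0 < τ := by rw [hτ]; linarith
    have hp1 : 0 < p - 1 := by linarith
    -- Lowering σ from 1/β by τ/(p-1) uses up exactly the gap τ in the bound on b; this needs p > 1.
    refine ⟨max 0 (1 / β - τ / (p - 1)), le_max_left _ _, ?_, ?_⟩
    · rw [← lt_div_iff₀ hβ0]
      refine max_lt (by positivity) ?_
      have : 0 < τ / (p - 1) := by positivity
      linarith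
    · have h1 : (1 / β - τ / (p - 1)) * (p - 1) ≤ max 0 (1 / β - τ / (p - 1)) * (p - 1) := by
        gcongr
        exact le_max_right _ _
      have h2 : (1 / β - τ / (p - 1)) * (p - 1) = (p - 1) / β - τ := by field_simp
      rw [hτ] at h2
      linarith
  obtain ⟨C₁, hC₁, H₁⟩ := exists_lintegral_rpow_sub_tentAverage_le hn0 hp.le hpq hs0.le hsq hab
    hopen hfr hbd
  obtain ⟨C₂, hC₂, H₂⟩ := hJ.exists_lintegral_tentAverage_sub_rpow_le hβ hlam hC₀ hopen hfr hbd
    hp.le hpq hs0.le ha hσ hσβ hbσ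
  set C := (2 ^ q * (C₁ + C₂)) ^ (1 / q) with hC
  have hCt : C ≠ ⊤ := ENNReal.rpow_ne_top_of_nonneg (by positivity) (ENNReal.mul_ne_top
    (ENNReal.rpow_ne_top_of_nonneg hq0.le (by norm_num)) (ENNReal.add_ne_top.2 ⟨hC₁, hC₂⟩))
  refine ⟨C.toReal + 1, by positivity, fun f hf => ?_⟩
  have hC' : C ≤ ENNReal.ofReal (C.toReal + 1) := by
    rw [← ENNReal.ofReal_toReal hCt, ENNReal.toReal_ofReal ENNReal.toReal_nonneg]
    exact ENNReal.ofReal_le_ofReal (by linarith)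
  -- Only the values on Ω matter, and the extension by zero is measurable on the whole space.
  set g := Ω.indicator f with hg
  have hgf : EqOn g f Ω := fun x hx => indicator_of_mem hx f
  have hgc : ContinuousOn g Ω := hf.continuousOn.congr hgf
  have hgm : Measurable g := by
    classical
    rw [hg, ← piecewise_eq_indicator]
    exact hf.continuousOn.measurable_piecewise continuousOn_const hopen.measurableSet
  rw [← fracSeminorm_congr hopen hgf, fracSeminorm_eq]
  set m := ∫⁻ w in Ω, fracEnergy Ω s p b g w with hm
  -- For infinite energy the right side is infinite, because the constant is positive; the transport
  -- estimate needs finite energy.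
  rcases eq_or_ne m ⊤ with hmt | hmt
  · have h0 : ENNReal.ofReal (C.toReal + 1) ≠ 0 := by
      have : 0 < C.toReal + 1 := by positivity
      simpa using this
    rw [hmt, ENNReal.top_rpow_of_pos (by positivity), ENNReal.mul_top h0]
    exact le_top
  refine (iInf_le _ (tentAverage Ω g x₀)).trans ?_
  rw [eLpNorm_weightedMeasure Ω hq0 ha]
  have hmain : ∫⁻ y in Ω, ‖f y - tentAverage Ω g x₀‖ₑ ^ q * ENNReal.ofReal (bdryDist Ω y) ^ a ≤
      2 ^ q * (C₁ + C₂) * m ^ (q / p) := by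
    have hmeas : Measurable fun y => ‖g y - tentAverage Ω g y‖ₑ ^ q *
        ENNReal.ofReal (bdryDist Ω y) ^ a :=
      ((hgm.sub (measurable_tentAverage Ω hgm)).enorm.pow_const q).mul
        ((continuous_bdryDist Ω).measurable.ennreal_ofReal.pow_const a)
    calc _ ≤ ∫⁻ y in Ω, 2 ^ q * (‖g y - tentAverage Ω g y‖ₑ ^ q *
          ENNReal.ofReal (bdryDist Ω y) ^ a + ‖tentAverage Ω g y - tentAverage Ω g x₀‖ₑ ^ q *
          ENNReal.ofReal (bdryDist Ω y) ^ a) := by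
          refine setLIntegral_mono' hopen.measurableSet fun y hy => ?_
          rw [← add_mul, ← mul_assoc, ← hgf hy]
          refine mul_le_mul_left (le_trans (ENNReal.rpow_le_rpow ?_ hq0.le)
            (ENNReal.add_rpow_le_two_rpow_mul hq0.le _ _)) _
          rw [← sub_add_sub_cancel (g y) (tentAverage Ω g y) (tentAverage Ω g x₀)]
          exact enorm_add_le _ _
      _ ≤ 2 ^ q * (C₁ * m ^ (q / p) + C₂ * m ^ (q / p)) := by
          rw [lintegral_const_mul' _ _ (ENNReal.rpow_ne_top_of_nonneg hq0.le (by norm_num)),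
            lintegral_add_left hmeas]
          exact mul_le_mul_right (add_le_add (H₁ g hgm hgc) (H₂ g hgm hgc hmt)) _
      _ = _ := by ring
  calc _ ≤ (2 ^ q * (C₁ + C₂) * m ^ (q / p)) ^ (1 / q) :=
        ENNReal.rpow_le_rpow hmain (by positivity)
    _ = C * m ^ (1 / p) := by
      rw [ENNReal.mul_rpow_of_nonneg _ _ (by positivity : 0 ≤ 1 / q), ← ENNReal.rpow_mul, hC]
      congr 2
      field_simp
    _ ≤ _ := by gcongr
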